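/- Let $d\ge 1$, let $A,B$ be standard Borel spaces, and use the norm $\|i\|=\max_{m}|i^{(m)}|$ on $\mathbb Z^d$ and the shifts $(T^jx)_i=x_{i+j}$ on $A^{\mathbb Z^d}$ and $B^{\mathbb Z^d}$. Let $X=(X_i)_{i\in\mathbb Z^d}$ be an i.i.d. $A$-valued random field. Let $\varphi:A^{\mathbb Z^d}\to B^{\mathbb Z^d}$ be a measurable map commuting with all shifts, with coding radius $$r_\varphi(x)=\inf\bigl\{r\in\mathbb N_0:\ \forall x',\ \bigl(x'_i=x_i\ \text{for all } \|i\|\le r\bigr)\Rightarrow \varphi(x')_0=\varphi(x)_0\bigr\}\in\mathbb N_0\cup\{\infty\},$$ and write $r_j(x)=r_\varphi(T^jx)$. Assume that $\varphi$ is a finitary coding of $X$, i.e. $r_\varphi(X)<\infty$ almost surely, and put $Y=\varphi(X)$. Assume moreover that the coding has the short-range factorization property with constant $\alpha\in(0,1]$: for all $k,\ell,i\in\mathbb Z^d$ with $\max\{\|\ell-i\|,\|k-i\|,\|\ell-k\|\}=\|\ell-i\|$, $$\mathbb P\bigl(\|k-i\|\le r_k(X),\ \|\ell-k\|\le r_\ell(X)\bigr)\le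 \mathbb P\bigl(\|k-i\|\le r_k(X)\bigr)\,\mathbb P\bigl(\alpha\|\ell-k\|\le r_\ell(X)\bigr).$$ For $f:B^{\mathbb Z^d}\to\mathbb R$ let $\delta_jf=\sup\{|f(y)-f(y')|: y_\ell=y'_\ell\ \forall \ell\ne j\}$ and $\|\delta f\|_2^2=\sum_{j\in\mathbb Z^d}(\delta_jf)^2$. Then for every measurable $f:B^{\mathbb Z^d}\to\mathbb R$ that is local (depends on finitely many coordinates only) and has the bounded-difference property ($\delta_jf<\infty$ for all $j$), the variable $f(Y)$ and all the exponentials below are integrable, and $$\log\mathbb E\bigl[\exp\{\lambda(f(Y)-\mathbb E f(Y))\}\bigr]\ \le\ 3\,\alpha^{-d}\,\lambda^2\,\bigl(\mathbb E[(2r_\varphi(X)+1)^d]\bigr)^2\,\|\delta f\|_2^2\qquad\text{for all }\lambda>0,$$ where the right-hand side is computed in $[0,\infty]$ with $0\cdot\infty=0$. In particular, $Y$ satisfies a Gaussian concentration bound as soon as the coding volume $(2r_\varphi(X)+1)^d$ has a finite first moment. -/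

import Mathlib

open MeasureTheory ProbabilityTheory
open scoped ENNReal

namespace FinitaryCoding

/-- The lattice `ℤ^d`. Its Mathlib norm and distance are the `ℓ^∞` ones. -/
abbrev Lattice (d : ℕ) : Type := Fin d → ℤ

/-- The shift `(T^j x)_i = x_{i+j}` on configurations. -/
def shift {d : ℕ} {S : Type*} (j : Lattice d) (x : Lattice d → S) : Lattice d → S :=
  fun i => x (i + j)

/-- A coding map: a measurable map that commutes with all shifts. -/
structure IsCodingMap {d : ℕ} {A B : Type*} [MeasurableSpace A] [MeasurableSpace B]
    (φ : (Lattice d → A) → (Lattice d → B)) : Prop where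
  measurable : Measurable φ
  shift_comm : ∀ (j : Lattice d) (x : Lattice d → A), φ (shift j x) = shift j (φ x)

/-- The pointwise coding radius at the origin: the least `r ∈ ℕ` such that the coordinates of `x`
in the closed `ℓ^∞` ball of radius `r` about `0` determine `φ(x)_0`, and `∞` if there is none. -/
noncomputable def codingRadius {d : ℕ} {A B : Type*} (φ : (Lattice d → A) → (Lattice d → B))
    (x : Lattice d → A) : ℕ∞ :=
  ⨅ (r : ℕ) (_ : ∀ x' : Lattice d → A,
    (∀ i ∈ Metric.closedBall (0 : Lattice d) (r : ℝ), x' i = x i) → φ x' 0 = φ x 0), (r : ℕ∞)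

/-- The coding radius at site `j`. -/
noncomputable def codingRadiusAt {d : ℕ} {A B : Type*} (φ : (Lattice d → A) → (Lattice d → B))
    (j : Lattice d) (x : Lattice d → A) : ℕ∞ :=
  codingRadius φ (shift j x)

/-- The coding volume `|B_∞(0, r)| = (2 r + 1)^d` at the origin, with values in `[0, ∞]`. -/
noncomputable def codingVolume {d : ℕ} {A B : Type*} (φ : (Lattice d → A) → (Lattice d → B))
    (x : Lattice d → A) : ℝ≥0∞ :=
  (2 * (codingRadius φ x : ℝ≥0∞) + 1) ^ d

/-- `X` is an i.i.d. random field with single-site law `ϱ`. -/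
structure IsIIDField {d : ℕ} {Ω A : Type*} [MeasurableSpace Ω] [MeasurableSpace A]
    (P : Measure Ω) (ϱ : Measure A) (X : Ω → Lattice d → A) : Prop where
  measurable : ∀ i, Measurable fun ω => X ω i
  indep : iIndepFun (fun (i : Lattice d) (ω : Ω) => X ω i) P
  law : ∀ i, P.map (fun ω => X ω i) = ϱ

/-- `φ` is a finitary coding of the field `X`: a coding map with `r_φ(X) < ∞` almost surely. -/
structure IsFinitaryCoding {d : ℕ} {Ω A B : Type*} [MeasurableSpace Ω] [MeasurableSpace A]
    [MeasurableSpace B] (P : Measure Ω) (X : Ω → Lattice d → A)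
    (φ : (Lattice d → A) → (Lattice d → B)) : Prop where
  isCodingMap : IsCodingMap φ
  radius_lt_top : ∀ᵐ ω ∂P, codingRadius φ (X ω) < ⊤

/-- The short-range factorization property with constant `α`; the expectations of (products of)
indicators are written as probabilities. -/
def ShortRangeFactorization {d : ℕ} {Ω A B : Type*} [MeasurableSpace Ω]
    (P : Measure Ω) (X : Ω → Lattice d → A) (φ : (Lattice d → A) → (Lattice d → B))
    (α : ℝ) : Prop :=
  ∀ k l i : Lattice d, max (max ‖l - i‖ ‖k - i‖) ‖l - k‖ = ‖l - i‖ →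
    P {ω | ENNReal.ofReal ‖k - i‖ ≤ (codingRadiusAt φ k (X ω) : ℝ≥0∞) ∧
        ENNReal.ofReal ‖l - k‖ ≤ (codingRadiusAt φ l (X ω) : ℝ≥0∞)} ≤
      P {ω | ENNReal.ofReal ‖k - i‖ ≤ (codingRadiusAt φ k (X ω) : ℝ≥0∞)} *
        P {ω | ENNReal.ofReal (α * ‖l - k‖) ≤ (codingRadiusAt φ l (X ω) : ℝ≥0∞)}

/-- The oscillation `δ_j f ∈ [0, ∞]` of `f` at site `j`. -/
noncomputable def oscillation {d : ℕ} {B : Type*} (f : (Lattice d → B) → ℝ) (j : Lattice d) :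
    ℝ≥0∞ :=
  ⨆ (y : Lattice d → B) (y' : Lattice d → B) (_ : ∀ l, l ≠ j → y l = y' l),
    ENNReal.ofReal |f y - f y'|

/-- `f` is local: it depends on finitely many coordinates only. -/
def IsLocal {d : ℕ} {B : Type*} (f : (Lattice d → B) → ℝ) : Prop :=
  ∃ Λ : Finset (Lattice d), DependsOn f (Λ : Set (Lattice d))

/-- The bounded-difference property: every oscillation is finite. -/
def HasBoundedDifferences {d : ℕ} {B : Type*} (f : (Lattice d → B) → ℝ) : Prop :=
  ∀ j, oscillation f j < ⊤

/-- `‖δ f‖_2^2`, the sum of the squared oscillations. -/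
noncomputable def oscillationNormSq {d : ℕ} {B : Type*} (f : (Lattice d → B) → ℝ) : ℝ≥0∞ :=
  ∑' j, oscillation f j ^ 2

end FinitaryCoding

/-!
The bound is proved directly for log-Laplace transforms, by tensorization, at two scales: single
sites and cubes of side `4`.

The functional inequality. Let `G` be a function of independent blocks of independent sites such
that, for all `x` and `y`, the increment `G y - G x` is at most a sum over the blocks in which `x`
and `y` differ, a block `b` contributing `∑ δ i` over its sites with `x i ≠ y i` plus a further
amount `K b x` that depends on `x` only. Then the logarithm of `E exp (t (G - E G))` is at most
`t² (½ ∑ δ² + ⅔ ∑ E K²)`. For one block (`integral_exp_le_of_block`), clipping `G` in every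
coordinate produces a majorant `m` with bounded differences `δ` and `G ≤ m - e` for some
`0 ≤ e ≤ K`; Hölder's inequality separates `m`, which McDiarmid's inequality controls, from `e`,
which enters with a negative sign and needs only its second moment. The hypothesis is stable under
partial log-Laplace transforms, which gives `integral_exp_le_of_blocks` by induction.

The coded field. If changing the configuration changes the symbol at `j`, then either the radius at
`j` is zero and the site `j` itself changed, or some changed site lies within the radius `r_j ≥ 1`,
and so does its cube up to the distance `cubeDist`. Hence one takes for `K` of a cube the sum
`reach` of the oscillations `δ_j f` over the sites `j` whose radius reaches the cube. Using all
`4 ^ d` grids of cubes and averaging turns `∑ E K²` into a sum over all positions of the cube, and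
only joint tails `P (r_j ≥ a, r_k ≥ b)` remain to be bounded, `a` and `b` being the distances of `j`
and `k` to the cube (`tsum_reach_sq_le`).

The joint tails. Write `c` for the distance of `j` and `k`. If `b ≥ c`, short-range factorization
with a third point at distance `a` from `j`, on the side opposite to `k`, gives
`P (r_j ≥ a) P (r_k ≥ α c)`; the case `a ≥ c` is symmetric. If `a, b < c`, both thresholds are
lowered where necessary to about `c / 2`; the two events are then decided in disjoint balls and are
independent (`measure_radius_inter_le_pairBound`). Summation over all positions yields at most
`15 / 4 * 4 ^ d * α⁻¹ ^ d * E²` with `E` the mean coding volume (`tsum_pairBound_le`). With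
`1 ≤ E` and `1 ≤ α⁻¹ ^ d`, the total constant is `1 / 2 + 2 / 3 * 15 / 4 = 3`. The summation
costs a factor `4 ^ d`, which the density `4 ^ (-d)` of each grid compensates; with single sites in
place of cubes a constant exponential in `d` would remain.

Measurability. The coding radius is only measurable with respect to the completion: the set where it
exceeds `n` is a cylinder over an analytic set. Analytic sets are universally measurable, so a Borel
radius that dominates it and agrees with it almost everywhere exists (`exists_measurable_radius`).
Cutting this radius off at a finite level makes the coded function depend on finitely many sites;
the level tends to infinity at the end.
-/

namespace FinitaryCoding

/-! ### Bounded functions, McDiarmid's inequality and essential suprema -/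

theorem integrable_of_abs_le {S : Type*} [MeasurableSpace S] {μ : Measure S} [IsFiniteMeasure μ]
    {F : S → ℝ} (hF : Measurable F) {C : ℝ} (hC : ∀ x, |F x| ≤ C) : Integrable F μ :=
  Integrable.of_bound hF.aestronglyMeasurable C (Filter.Eventually.of_forall hC)

theorem integrable_exp_of_abs_le {S : Type*} [MeasurableSpace S] {μ : Measure S}
    [IsFiniteMeasure μ] {F : S → ℝ} (hF : Measurable F) {C : ℝ} (hC : ∀ x, |F x| ≤ C) (t : ℝ) :
    Integrable (fun x => Real.exp (t * F x)) μ := by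
  refine integrable_of_abs_le (by fun_prop) (C := Real.exp (|t| * C)) fun x => ?_
  rw [Real.abs_exp]
  apply Real.exp_le_exp.2
  calc t * F x ≤ |t * F x| := le_abs_self _
    _ = |t| * |F x| := abs_mul _ _
    _ ≤ |t| * C := by gcongr; exact hC x

/-- Fubini for the first coordinate of a finite i.i.d. tuple. -/
theorem integral_pi_succ {S : Type*} [MeasurableSpace S] (μ : Measure S) [IsProbabilityMeasure μ]
    {n : ℕ} (F : (Fin (n + 1) → S) → ℝ) (hF : Integrable F (Measure.pi fun _ => μ)) :
    ∫ x, F x ∂(Measure.pi fun _ => μ) =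
      ∫ a, ∫ y, F (Fin.cons a y) ∂(Measure.pi fun _ => μ) ∂μ := by
  have h := (measurePreserving_piFinSuccAbove (fun _ : Fin (n + 1) => μ) 0).symm
  rw [← h.integral_comp' F, integral_prod]
  · refine integral_congr_ae (Filter.Eventually.of_forall fun a => ?_)
    refine integral_congr_ae (Filter.Eventually.of_forall fun y => ?_)
    simp [MeasurableEquiv.piFinSuccAbove, Fin.consEquiv]
  · exact (h.integrable_comp_emb (MeasurableEquiv.measurableEmbedding _)).2 hF

@[fun_prop]
theorem measurable_cons {S : Type*} [MeasurableSpace S] {n : ℕ} :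
    Measurable fun p : S × (Fin n → S) => (Fin.cons p.1 p.2 : Fin (n + 1) → S) := by
  refine measurable_pi_lambda _ fun i => ?_
  refine Fin.cases ?_ (fun j => ?_) i
  · simpa using measurable_fst
  · simp only [Fin.cons_succ]
    fun_prop

theorem abs_integral_le_of_abs_le {S : Type*} [MeasurableSpace S] {μ : Measure S}
    [IsProbabilityMeasure μ] {F : S → ℝ} {C : ℝ} (hC : ∀ x, |F x| ≤ C) : |∫ x, F x ∂μ| ≤ C := by
  have h := norm_integral_le_of_norm_le_const (μ := μ) (f := F) (C := C)
    (Filter.Eventually.of_forall hC)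
  simpa using h

/-- Hoeffding's lemma for a function of one variable whose values differ by at most `δ`. -/
theorem integral_exp_le_of_oscillation {S : Type*} [MeasurableSpace S] (μ : Measure S)
    [IsProbabilityMeasure μ] {H : S → ℝ} (hH : Measurable H) {C : ℝ} (hC : ∀ x, |H x| ≤ C)
    {δ : ℝ} (hδ : ∀ x y, H x ≤ H y + δ) (θ : ℝ) :
    ∫ x, Real.exp (θ * H x) ∂μ ≤ Real.exp (θ * ∫ x, H x ∂μ + θ ^ 2 / 8 * δ ^ 2) := by
  have : Nonempty S := nonempty_of_isProbabilityMeasure μ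
  have hbd : BddBelow (Set.range H) := ⟨-C, by
    rintro _ ⟨x, rfl⟩
    exact (abs_le.1 (hC x)).1⟩
  have hmem : ∀ x, H x ∈ Set.Icc (⨅ y, H y) ((⨅ y, H y) + δ) := by
    intro x
    refine ⟨ciInf_le hbd x, ?_⟩
    have : H x - δ ≤ ⨅ y, H y := le_ciInf fun y => by linarith [hδ x y]
    linarith
  have h := (hasSubgaussianMGF_of_mem_Icc (μ := μ) hH.aemeasurable
    (Filter.Eventually.of_forall hmem)).mgf_le θ
  rw [mgf] at h
  -- the variance proxy of a variable with values in an interval of length `δ`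
  have hδ0 : ((‖(⨅ y, H y) + δ - ⨅ y, H y‖₊ / 2 : NNReal) ^ 2 : NNReal) = δ ^ 2 / 4 := by
    simp only [add_sub_cancel_left, NNReal.coe_pow, NNReal.coe_div, coe_nnnorm, NNReal.coe_ofNat,
      Real.norm_eq_abs, div_pow, sq_abs]
    norm_num
  push_cast at h hδ0
  rw [hδ0] at h
  have hsplit : ∀ x, Real.exp (θ * H x) =
      Real.exp (θ * ∫ x, H x ∂μ) * Real.exp (θ * (H x - ∫ x, H x ∂μ)) := by
    intro x
    rw [← Real.exp_add]
    ring_nf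
  simp_rw [hsplit]
  rw [integral_const_mul, Real.exp_add]
  gcongr
  calc _ ≤ _ := h
    _ = _ := by ring_nf

/-- McDiarmid's inequality in its exponential form: a function of independent variables that moves
by at most `δ k` when the `k`-th variable changes is sub-Gaussian with variance `∑ δ k ^ 2 / 4`. -/
theorem integral_exp_le_of_boundedDifferences {S : Type*} [MeasurableSpace S] (μ : Measure S)
    [IsProbabilityMeasure μ] {n : ℕ} {G : (Fin n → S) → ℝ} (hG : Measurable G) {C : ℝ}
    (hC : ∀ x, |G x| ≤ C) {δ : Fin n → ℝ}
    (hδ : ∀ k x a, G (Function.update x k a) ≤ G x + δ k) (θ : ℝ) :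
    ∫ x, Real.exp (θ * G x) ∂(Measure.pi fun _ => μ) ≤
      Real.exp (θ * ∫ x, G x ∂(Measure.pi fun _ => μ) + θ ^ 2 / 8 * ∑ k, δ k ^ 2) := by
  induction n with
  | zero =>
    have : Measure.pi (fun _ : Fin 0 => μ) = Measure.dirac (fun i => i.elim0) :=
      Measure.pi_of_empty _ _
    rw [this, integral_dirac, integral_dirac]
    simp
  | succ n ih =>
    rw [integral_pi_succ μ _ (integrable_exp_of_abs_le hG hC θ),
      integral_pi_succ μ _ (integrable_of_abs_le hG hC)]
    set ν : Measure (Fin n → S) := Measure.pi fun _ => μ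
    have hGc : Measurable fun p : S × (Fin n → S) => G (Fin.cons p.1 p.2) :=
      hG.comp measurable_cons
    set H : S → ℝ := fun a => ∫ y, G (Fin.cons a y) ∂ν with hHdef
    have hH : Measurable H :=
      (StronglyMeasurable.integral_prod_right (f := fun a y => G (Fin.cons a y))
        hGc.stronglyMeasurable).measurable
    have hHC : ∀ a, |H a| ≤ C := fun a => abs_integral_le_of_abs_le fun y => hC _
    have hint : ∀ a, Integrable (fun y => G (Fin.cons a y)) ν := fun a =>
      integrable_of_abs_le (hGc.comp measurable_prodMk_left) fun y => hC _
    -- the bound for the remaining variables, with the first one fixed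
    have hinner : ∀ a, ∫ y, Real.exp (θ * G (Fin.cons a y)) ∂ν ≤
        Real.exp (θ ^ 2 / 8 * ∑ k : Fin n, δ k.succ ^ 2) * Real.exp (θ * H a) := by
      intro a
      rw [← Real.exp_add, add_comm (θ ^ 2 / 8 * _)]
      refine ih (G := fun y => G (Fin.cons a y)) (hGc.comp measurable_prodMk_left)
        (fun y => hC _) (δ := fun k => δ k.succ) fun k y b => ?_
      rw [Fin.cons_update]
      exact hδ k.succ _ b
    have hosc : ∀ a b, H a ≤ H b + δ 0 := by
      intro a b
      have : H a ≤ ∫ y, (G (Fin.cons b y) + δ 0) ∂ν := by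
        refine integral_mono (hint a) ((hint b).add (integrable_const _)) fun y => ?_
        have := hδ 0 (Fin.cons b y) a
        rwa [Fin.update_cons_zero] at this
      rw [integral_add (hint b) (integrable_const _)] at this
      simpa using this
    calc ∫ a, ∫ y, Real.exp (θ * G (Fin.cons a y)) ∂ν ∂μ
        ≤ ∫ a, Real.exp (θ ^ 2 / 8 * ∑ k : Fin n, δ k.succ ^ 2) * Real.exp (θ * H a) ∂μ := by
          refine integral_mono_of_nonneg
            (Filter.Eventually.of_forall fun a => integral_nonneg fun y => (Real.exp_pos _).le)
            ((integrable_exp_of_abs_le hH hHC θ).const_mul _) (Filter.Eventually.of_forall hinner)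
      _ = Real.exp (θ ^ 2 / 8 * ∑ k : Fin n, δ k.succ ^ 2) * ∫ a, Real.exp (θ * H a) ∂μ :=
          integral_const_mul _ _
      _ ≤ Real.exp (θ ^ 2 / 8 * ∑ k : Fin n, δ k.succ ^ 2) *
            Real.exp (θ * ∫ a, H a ∂μ + θ ^ 2 / 8 * δ 0 ^ 2) := by
          gcongr
          exact integral_exp_le_of_oscillation μ hH hHC hosc θ
      _ = _ := by
          rw [← Real.exp_add, Fin.sum_univ_succ]
          ring_nf

theorem ae_le_essSup_of_abs_le {S : Type*} [MeasurableSpace S] (μ : Measure S)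
    {h : S → ℝ} {C : ℝ} (hC : ∀ x, |h x| ≤ C) :
    ∀ᵐ x ∂μ, h x ≤ essSup h μ :=
  ae_le_essSup ⟨C, by simpa using Filter.Eventually.of_forall fun x => (abs_le.1 (hC x)).2⟩

section EssSup

-- The real-valued `essSup` is meaningful for bounded functions only, whence the bounds `hC`.

variable {S : Type*} [MeasurableSpace S] (μ : Measure S) [IsProbabilityMeasure μ]

theorem essSup_le_of_forall_le {h : S → ℝ} {C : ℝ} (hC : ∀ x, |h x| ≤ C) {c : ℝ}
    (hc : ∀ x, h x ≤ c) : essSup h μ ≤ c := by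
  rw [essSup_eq_sInf]
  refine csInf_le ⟨-C - 1, fun q hq => ?_⟩ ?_
  · by_contra hlt
    push Not at hlt
    have : {x | q < h x} = Set.univ := by
      ext x
      simp only [Set.mem_ofPred_eq, Set.mem_univ, iff_true]
      linarith [(abs_le.1 (hC x)).1]
    simp [this] at hq
  · have : {x | c < h x} = ∅ := by
      ext x
      simpa using hc x
    simp [this]

theorem lt_essSup_iff_of_abs_le {h : S → ℝ} {C : ℝ} (hC : ∀ x, |h x| ≤ C) {q : ℝ} :
    q < essSup h μ ↔ 0 < μ {x | q < h x} := by
  constructor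
  · intro hq
    by_contra h0
    have h0' : μ {x | q < h x} = 0 := by simpa using h0
    refine absurd hq (not_lt.2 ?_)
    rw [essSup_eq_sInf]
    refine csInf_le ⟨-C - 1, fun q hq => ?_⟩ h0'
    by_contra hlt
    push Not at hlt
    have : {x | q < h x} = Set.univ := by
      ext x
      simp only [Set.mem_ofPred_eq, Set.mem_univ, iff_true]
      linarith [(abs_le.1 (hC x)).1]
    simp [this] at hq
  · intro hpos
    by_contra hle
    push Not at hle
    have : μ {x | q < h x} = 0 := by
      have h1 := ae_le_essSup_of_abs_le μ hC
      rw [ae_iff] at h1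
      refine measure_mono_null (fun x hx => ?_) h1
      simp only [Set.mem_ofPred_eq, not_le] at hx ⊢
      linarith
    simp [this] at hpos

theorem le_essSup_of_forall_le {h : S → ℝ} {C : ℝ} (hC : ∀ x, |h x| ≤ C) {c : ℝ}
    (hc : ∀ x, c ≤ h x) : c ≤ essSup h μ := by
  obtain ⟨x, hx⟩ := (ae_le_essSup_of_abs_le μ hC).exists
  exact (hc x).trans hx

theorem essSup_le_essSup_add {h k : S → ℝ} {C D : ℝ} (hC : ∀ x, |h x| ≤ C) (hD : ∀ x, |k x| ≤ D)
    {c : ℝ} (hc : ∀ x, h x ≤ k x + c) : essSup h μ ≤ essSup k μ + c := by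
  refine le_of_forall_lt fun q hq => ?_
  rw [lt_essSup_iff_of_abs_le μ hC] at hq
  have : q - c < essSup k μ := by
    rw [lt_essSup_iff_of_abs_le μ hD]
    refine hq.trans_le (measure_mono fun x hx => ?_)
    simp only [Set.mem_ofPred_eq] at hx ⊢
    linarith [hc x]
  linarith

/-- Joint measurability suffices here because `q < essSup h` only asks whether a superlevel set has
positive measure. A pointwise supremum would only be analytically measurable. -/
theorem measurable_essSup {T : Type*} [MeasurableSpace T] {h : T → S → ℝ}
    (hm : Measurable (Function.uncurry h)) {C : ℝ} (hC : ∀ t x, |h t x| ≤ C) :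
    Measurable fun t => essSup (h t) μ := by
  refine measurable_of_Ioi fun q => ?_
  have : (fun t => essSup (h t) μ) ⁻¹' Set.Ioi q =
      {t | 0 < μ (Prod.mk t ⁻¹' {p | q < Function.uncurry h p})} := by
    ext t
    simp only [Set.mem_preimage, Set.mem_Ioi, Set.mem_ofPred_eq]
    exact lt_essSup_iff_of_abs_le μ (hC t)
  rw [this]
  exact measurableSet_lt measurable_const
    (measurable_measure_prodMk_left (measurableSet_lt measurable_const hm))

end EssSup

/-! ### Clipping to bounded differences -/

section Clip

variable {S : Type*} [MeasurableSpace S] (μ : Measure S) {n : ℕ}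
  {m : (Fin n → S) → ℝ} {C : ℝ}

/-- The essential supremum of `m` over the `k`-th coordinate, the others being kept. -/
noncomputable def coordSup (k : Fin n) (m : (Fin n → S) → ℝ) (x : Fin n → S) : ℝ :=
  essSup (fun a => m (Function.update x k a)) μ

/-- The function `m` clipped to the interval `[E - c, E]`, where `E` is its essential supremum over
the `k`-th coordinate. As a function of this coordinate it oscillates by at most `c`. -/
noncomputable def clip (k : Fin n) (c : ℝ) (m : (Fin n → S) → ℝ) (x : Fin n → S) : ℝ :=
  max (min (m x) (coordSup μ k m x)) (coordSup μ k m x - c)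

theorem coordSup_update (k : Fin n) (x : Fin n → S) (a : S) :
    coordSup μ k m (Function.update x k a) = coordSup μ k m x := by
  simp [coordSup]

theorem clip_update_self_le (k : Fin n) {c : ℝ} (hc : 0 ≤ c) (x : Fin n → S) (a : S) :
    clip μ k c m (Function.update x k a) ≤ clip μ k c m x + c := by
  have h1 : clip μ k c m (Function.update x k a) ≤ coordSup μ k m x := by
    rw [clip, coordSup_update]
    exact max_le (min_le_right _ _) (by linarith)
  have h2 : coordSup μ k m x - c ≤ clip μ k c m x := le_max_right _ _
  linarith

variable [IsProbabilityMeasure μ]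

theorem measurable_coordSup (k : Fin n) (hm : Measurable m) (hC : ∀ x, |m x| ≤ C) :
    Measurable (coordSup μ k m) :=
  measurable_essSup μ (h := fun x a => m (Function.update x k a))
    (hm.comp measurable_update') fun _ _ => hC _

theorem measurable_clip (k : Fin n) (c : ℝ) (hm : Measurable m) (hC : ∀ x, |m x| ≤ C) :
    Measurable (clip μ k c m) := by
  have := measurable_coordSup μ k hm hC
  exact (hm.min this).max (this.sub_const c)

theorem abs_clip_le (k : Fin n) {c : ℝ} (hc : 0 ≤ c) (hC : ∀ x, |m x| ≤ C) (x : Fin n → S) :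
    |clip μ k c m x| ≤ C := by
  have h1 : coordSup μ k m x ≤ C :=
    essSup_le_of_forall_le μ (fun _ => hC _) fun _ => (abs_le.1 (hC _)).2
  have h2 : -C ≤ coordSup μ k m x :=
    le_essSup_of_forall_le μ (fun _ => hC _) fun _ => (abs_le.1 (hC _)).1
  have h3 := abs_le.1 (hC x)
  refine abs_le.2 ⟨le_max_of_le_left (le_min h3.1 h2), max_le ((min_le_left _ _).trans h3.2) ?_⟩
  linarith

theorem clip_update_le {k l : Fin n} (hkl : k ≠ l) (c : ℝ) (hC : ∀ x, |m x| ≤ C) {δ : ℝ}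
    (hδ : ∀ x a, m (Function.update x l a) ≤ m x + δ) (x : Fin n → S) (a : S) :
    clip μ k c m (Function.update x l a) ≤ clip μ k c m x + δ := by
  have h1 : coordSup μ k m (Function.update x l a) ≤ coordSup μ k m x + δ := by
    refine essSup_le_essSup_add μ (fun _ => hC _) (fun _ => hC _) fun b => ?_
    rw [Function.update_comm hkl.symm]
    exact hδ _ _
  have h2 := hδ x a
  rw [clip, clip, ← max_add_add_right, ← min_add_add_right]
  exact max_le_max (min_le_min h2 h1) (by linarith)

/-- Clipping lowers a function on a null set only: the part above the essential supremum is null by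
Fubini. -/
theorem ae_le_clip (k : Fin n) (c : ℝ) (hm : Measurable m) (hC : ∀ x, |m x| ≤ C) :
    m ≤ᵐ[Measure.pi fun _ => μ] clip μ k c m := by
  have hmeas : MeasurableSet {x | coordSup μ k m x < m x} :=
    measurableSet_lt (measurable_coordSup μ k hm hC) hm
  have hnull : ∫⁻ x, Set.indicator {x | coordSup μ k m x < m x} 1 x ∂(Measure.pi fun _ => μ) =
      ∫⁻ _ : Fin n → S, 0 ∂(Measure.pi fun _ => μ) := by
    refine lintegral_eq_of_lmarginal_eq {k} (measurable_one.indicator hmeas) measurable_const ?_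
    rw [lmarginal_singleton, lmarginal_singleton]
    funext x
    rw [lintegral_zero]
    refine (lintegral_eq_zero_iff
      ((measurable_one.indicator hmeas).comp (measurable_update x))).2 ?_
    have h := ae_le_essSup_of_abs_le μ (h := fun a => m (Function.update x k a)) fun _ => hC _
    filter_upwards [h] with a ha
    simp only [Function.comp_apply, Pi.zero_apply, Set.indicator_apply_eq_zero,
      Set.mem_ofPred_eq, coordSup_update]
    exact fun h' => absurd ha (not_le.2 h')
  rw [lintegral_indicator_one hmeas, lintegral_zero] at hnull
  have hae : ∀ᵐ x ∂(Measure.pi fun _ => μ), m x ≤ coordSup μ k m x := by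
    rw [ae_iff]
    simpa using hnull
  filter_upwards [hae] with x hx
  exact le_max_of_le_left (le_min le_rfl hx)


open Classical in
/-- A function dominated by `c + ∑ δ i 1{x i ≠ z i}` keeps this bound under clipping. -/
theorem clip_le_add_sum (k : Fin n) {δ : Fin n → ℝ} (hδ : ∀ i, 0 ≤ δ i) (hC : ∀ x, |m x| ≤ C)
    {c : ℝ} {z : Fin n → S} (hm : ∀ x, m x ≤ c + ∑ i, if x i ≠ z i then δ i else 0)
    (x : Fin n → S) : clip μ k (δ k) m x ≤ c + ∑ i, if x i ≠ z i then δ i else 0 := by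
  refine max_le ((min_le_left _ _).trans (hm x)) ?_
  have h : coordSup μ k m x ≤ c + (∑ i, if x i ≠ z i then δ i else 0) + δ k := by
    refine essSup_le_of_forall_le μ (fun _ => hC _) fun a => (hm _).trans ?_
    rw [add_assoc]
    gcongr
    rw [← Finset.add_sum_erase _ _ (Finset.mem_univ k),
      ← Finset.add_sum_erase _ (fun i => if x i ≠ z i then δ i else 0) (Finset.mem_univ k)]
    have h1 : (∑ i ∈ Finset.univ.erase k, if Function.update x k a i ≠ z i then δ i else 0) =
        ∑ i ∈ Finset.univ.erase k, if x i ≠ z i then δ i else 0 := by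
      refine Finset.sum_congr rfl fun i hi => ?_
      rw [Function.update_of_ne (Finset.ne_of_mem_erase hi)]
    have h2 : (if Function.update x k a k ≠ z k then δ k else 0) ≤ δ k := by
      split_ifs
      exacts [le_rfl, hδ k]
    have h3 : 0 ≤ if x k ≠ z k then δ k else 0 := by
      split_ifs
      exacts [hδ k, le_rfl]
    rw [h1]
    linarith
  linarith

open Classical in
/-- Regularization: a function with `G x ≤ u z + ∑ δ i 1{x i ≠ z i}` for all `x` and `z` lies,
almost everywhere, below a function that is bounded by `u` and moves by at most `δ k` when the
`k`-th coordinate changes. -/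
theorem exists_boundedDifferences_majorant {G u : (Fin n → S) → ℝ} (hG : Measurable G)
    (hC : ∀ x, |G x| ≤ C) {δ : Fin n → ℝ} (hδ : ∀ i, 0 ≤ δ i)
    (h : ∀ x z, G x ≤ u z + ∑ i, if x i ≠ z i then δ i else 0) :
    ∃ m : (Fin n → S) → ℝ, Measurable m ∧ (∀ x, |m x| ≤ C) ∧
      G ≤ᵐ[Measure.pi fun _ => μ] m ∧
      (∀ k x a, m (Function.update x k a) ≤ m x + δ k) ∧ ∀ x, m x ≤ u x := by
  have key : ∀ s : Finset (Fin n), ∃ m : (Fin n → S) → ℝ, Measurable m ∧ (∀ x, |m x| ≤ C) ∧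
      G ≤ᵐ[Measure.pi fun _ => μ] m ∧
      (∀ k ∈ s, ∀ x a, m (Function.update x k a) ≤ m x + δ k) ∧
      ∀ x z, m x ≤ u z + ∑ i, if x i ≠ z i then δ i else 0 := by
    intro s
    induction s using Finset.induction_on with
    | empty => exact ⟨G, hG, hC, Filter.EventuallyLE.rfl, by simp, h⟩
    | insert k s _ ih =>
      obtain ⟨m, hm, hmC, hGm, hosc, hmu⟩ := ih
      -- clipping in the direction `k` preserves the bounds already obtained in the directions `s`
      refine ⟨clip μ k (δ k) m, measurable_clip μ k _ hm hmC, abs_clip_le μ k (hδ k) hmC,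
        hGm.trans (ae_le_clip μ k _ hm hmC), fun l hl x a => ?_,
        fun x z => clip_le_add_sum μ k hδ hmC (fun y => hmu y z) x⟩
      rcases eq_or_ne k l with rfl | hkl
      · exact clip_update_self_le μ k (hδ k) x a
      · exact clip_update_le μ hkl _ hmC
          (hosc l ((Finset.mem_insert.1 hl).resolve_left hkl.symm)) x a
  obtain ⟨m, hm, hmC, hGm, hosc, hmu⟩ := key Finset.univ
  exact ⟨m, hm, hmC, hGm, fun k => hosc k (Finset.mem_univ k), fun x => by simpa using hmu x x⟩

end Clip

/-! ### The exponential inequality for one block -/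

theorem exp_neg_le {s : ℝ} (hs : 0 ≤ s) : Real.exp (-s) ≤ 1 - s + s ^ 2 / 2 := by
  have h := Real.quadratic_le_exp_of_nonneg hs
  have hpos : 0 < 1 + s + s ^ 2 / 2 := by positivity
  rw [Real.exp_neg]
  refine (inv_anti₀ hpos h).trans ?_
  rw [inv_le_iff_one_le_mul₀ hpos]
  nlinarith [sq_nonneg (s ^ 2)]

/-- Bound on the exponential moment of a nonnegative variable with a negative exponent. -/
theorem integral_exp_neg_le {S : Type*} [MeasurableSpace S] (μ : Measure S)
    [IsProbabilityMeasure μ] {s : S → ℝ} (hs : Measurable s) {C : ℝ} (hC : ∀ x, |s x| ≤ C)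
    (h0 : ∀ x, 0 ≤ s x) :
    ∫ x, Real.exp (-s x) ∂μ ≤ Real.exp (-∫ x, s x ∂μ + (∫ x, s x ^ 2 ∂μ) / 2) := by
  have hi : Integrable s μ := integrable_of_abs_le hs hC
  have hi2 : Integrable (fun x => s x ^ 2) μ := by
    refine integrable_of_abs_le (by fun_prop) (C := C ^ 2) fun x => ?_
    rw [abs_pow]
    exact pow_le_pow_left₀ (abs_nonneg _) (hC x) 2
  have hexp : Integrable (fun x => Real.exp (-s x)) μ := by
    simpa using integrable_exp_of_abs_le hs hC (-1)
  have h1i : Integrable (fun x => 1 - s x) μ := (integrable_const 1).sub hi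
  have h2i : Integrable (fun x => s x ^ 2 / 2) μ := hi2.div_const 2
  calc ∫ x, Real.exp (-s x) ∂μ ≤ ∫ x, ((1 - s x) + s x ^ 2 / 2) ∂μ :=
        integral_mono hexp (h1i.add h2i) fun x => exp_neg_le (h0 x)
    _ = (-∫ x, s x ∂μ + (∫ x, s x ^ 2 ∂μ) / 2) + 1 := by
        rw [integral_add h1i h2i, integral_sub (integrable_const 1) hi, integral_div]
        simp
        ring
    _ ≤ _ := Real.add_one_le_exp _

open Classical in
/-- The exponential inequality for one block of `n` sites. The increments of `G` are measured in
two scales: site by site through `δ`, and, as soon as the block has changed at all, through the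
random variable `K` evaluated at the unperturbed configuration. Replacing `G` by a majorant `m` with
bounded differences `δ`, writing `G ≤ m - e` with `0 ≤ e ≤ K`, and separating `m` from `e` by
Hölder's inequality with exponents `4` and `4 / 3` reduces the claim to McDiarmid's inequality. -/
theorem integral_exp_le_of_block {S : Type*} [MeasurableSpace S] (μ : Measure S)
    [IsProbabilityMeasure μ] {n : ℕ} {G g K : (Fin n → S) → ℝ} (hG : Measurable G)
    (hg : Measurable g) (hK : Measurable K) {C : ℝ} (hGC : ∀ x, |G x| ≤ C)
    (hgC : ∀ x, |g x| ≤ C) (hKC : ∀ x, |K x| ≤ C) (hK0 : ∀ x, 0 ≤ K x) {δ : Fin n → ℝ}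
    (hδ : ∀ i, 0 ≤ δ i)
    (h : ∀ x y, G y ≤ g x + if x ≠ y then (∑ i, if x i ≠ y i then δ i else 0) + K x else 0)
    {t : ℝ} (ht : 0 < t) :
    ∫ x, Real.exp (t * G x) ∂(Measure.pi fun _ => μ) ≤
      Real.exp (t * ∫ x, g x ∂(Measure.pi fun _ => μ) +
        t ^ 2 * ((∑ i, δ i ^ 2) / 2 + 2 / 3 * ∫ x, K x ^ 2 ∂(Measure.pi fun _ => μ))) := by
  set ν : Measure (Fin n → S) := Measure.pi fun _ => μ with hν
  obtain ⟨m, hm, hmC, hGm, hosc, hmu⟩ :=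
    exists_boundedDifferences_majorant μ hG hGC hδ (u := fun z => g z + K z) (by
      intro x z
      refine (h z x).trans ?_
      have h0 : 0 ≤ ∑ i, if x i ≠ z i then δ i else 0 :=
        Finset.sum_nonneg fun i _ => by split_ifs <;> simp [hδ i]
      by_cases hzx : z = x
      · simp only [hzx, ne_eq, not_true_eq_false, if_false, Finset.sum_const_zero, add_zero]
        exact le_add_of_nonneg_right (hK0 x)
      · simp only [ne_eq, hzx, not_false_eq_true, if_true]
        simp_rw [eq_comm (a := z _)]
        linarith)
  set g' : (Fin n → S) → ℝ := fun x => min (m x) (g x) with hg'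
  have hg'm : Measurable g' := hm.min hg
  have hg'C : ∀ x, |g' x| ≤ C := fun x => by
    have h1 := abs_le.1 (hmC x)
    have h2 := abs_le.1 (hgC x)
    exact abs_le.2 ⟨le_min h1.1 h2.1, (min_le_left _ _).trans h1.2⟩
  set e : (Fin n → S) → ℝ := fun x => m x - g' x with he
  have hem : Measurable e := hm.sub hg'm
  have he0 : ∀ x, 0 ≤ e x := fun x => sub_nonneg.2 (min_le_left _ _)
  have heK : ∀ x, e x ≤ K x := fun x => by
    have h1 := hmu x
    have h2 := hK0 x
    have h3 : m x - K x ≤ g' x := le_min (by linarith) (by linarith)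
    simp only [he]
    linarith
  have heC : ∀ x, |e x| ≤ C := fun x => by
    rw [abs_of_nonneg (he0 x)]
    exact (heK x).trans ((le_abs_self _).trans (hKC x))
  have hGg : ∀ x, G x ≤ g x := fun x => by simpa using h x x
  have hGg' : ∀ᵐ x ∂ν, G x ≤ g' x := by
    filter_upwards [hGm] with x hx
    exact le_min hx (hGg x)
  have hK2 : Integrable (fun x => K x ^ 2) ν := by
    refine integrable_of_abs_le (by fun_prop) (C := C ^ 2) fun x => ?_
    rw [abs_pow]
    exact pow_le_pow_left₀ (abs_nonneg _) (hKC x) 2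
  have he2 : Integrable (fun x => e x ^ 2) ν := by
    refine integrable_of_abs_le (by fun_prop) (C := C ^ 2) fun x => ?_
    rw [abs_pow]
    exact pow_le_pow_left₀ (abs_nonneg _) (heC x) 2
  have hconj : (4 : ℝ).HolderConjugate (4 / 3) := by
    rw [Real.holderConjugate_iff]
    norm_num
  have hmem : ∀ {F : (Fin n → S) → ℝ} (_ : Measurable F) (_ : ∀ x, |F x| ≤ C) (c : ℝ)
      (p : ℝ≥0∞), MemLp (fun x => Real.exp (c * F x)) p ν := by
    intro F hF hFC c p
    refine MemLp.of_bound (by fun_prop) (Real.exp (|c| * C))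
      (Filter.Eventually.of_forall fun x => ?_)
    rw [Real.norm_eq_abs, Real.abs_exp]
    apply Real.exp_le_exp.2
    calc c * F x ≤ |c * F x| := le_abs_self _
      _ = |c| * |F x| := abs_mul _ _
      _ ≤ |c| * C := by gcongr; exact hFC x
  have hexp_rpow : ∀ (a b : ℝ), Real.exp a ^ b = Real.exp (a * b) := fun a b =>
    (Real.exp_mul a b).symm
  -- McDiarmid's inequality for the majorant
  have hfirst : ∫ x, Real.exp (t * m x) ^ (4 : ℝ) ∂ν ≤
      Real.exp (4 * t * ∫ x, m x ∂ν + (4 * t) ^ 2 / 8 * ∑ i, δ i ^ 2) := by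
    have := integral_exp_le_of_boundedDifferences μ hm hmC hosc (4 * t)
    refine le_trans (le_of_eq ?_) this
    refine integral_congr_ae (Filter.Eventually.of_forall fun x => ?_)
    simp only [hexp_rpow]
    ring_nf
  -- the correction enters with a negative sign, so that its second moment suffices
  have hsecond : ∫ x, Real.exp (-t * e x) ^ (4 / 3 : ℝ) ∂ν ≤
      Real.exp (-(4 / 3 * t * ∫ x, e x ∂ν) + (4 / 3 * t) ^ 2 * (∫ x, K x ^ 2 ∂ν) / 2) := by
    have hs := integral_exp_neg_le ν (s := fun x => 4 / 3 * t * e x) (hem.const_mul _)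
      (C := 4 / 3 * t * C) (fun x => by
        rw [abs_mul, abs_of_pos (by positivity : (0 : ℝ) < 4 / 3 * t)]
        gcongr
        exact heC x) (fun x => mul_nonneg (by positivity) (he0 x))
    have hlhs : ∫ x, Real.exp (-t * e x) ^ (4 / 3 : ℝ) ∂ν =
        ∫ x, Real.exp (-(4 / 3 * t * e x)) ∂ν := by
      refine integral_congr_ae (Filter.Eventually.of_forall fun x => ?_)
      simp only [hexp_rpow]
      ring_nf
    rw [hlhs]
    refine hs.trans (Real.exp_le_exp.2 ?_)
    simp_rw [mul_pow]
    rw [integral_const_mul, integral_const_mul]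
    have : ∫ x, e x ^ 2 ∂ν ≤ ∫ x, K x ^ 2 ∂ν :=
      integral_mono he2 hK2 fun x => pow_le_pow_left₀ (he0 x) (heK x) 2
    have ht2 : 0 ≤ (4 / 3 : ℝ) ^ 2 * t ^ 2 := by positivity
    nlinarith [mul_le_mul_of_nonneg_left this ht2]
  have hg'le : ∫ x, m x ∂ν - ∫ x, e x ∂ν ≤ ∫ x, g x ∂ν := by
    rw [← integral_sub (integrable_of_abs_le hm hmC) (integrable_of_abs_le hem heC)]
    refine integral_mono ((integrable_of_abs_le hm hmC).sub (integrable_of_abs_le hem heC))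
      (integrable_of_abs_le hg hgC) fun x => ?_
    simp only [he, sub_sub_cancel]
    exact min_le_right _ _
  calc ∫ x, Real.exp (t * G x) ∂ν ≤ ∫ x, Real.exp (t * m x) * Real.exp (-t * e x) ∂ν := by
        refine integral_mono_ae (integrable_exp_of_abs_le hG hGC t) ?_ ?_
        · simp_rw [← Real.exp_add]
          have : ∀ x, t * m x + -t * e x = t * g' x := fun x => by simp only [he]; ring
          simp_rw [this]
          exact integrable_exp_of_abs_le hg'm hg'C t
        · filter_upwards [hGg'] with x hx
          rw [← Real.exp_add]
          apply Real.exp_le_exp.2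
          have : t * m x + -t * e x = t * g' x := by simp only [he]; ring
          rw [this]
          gcongr
    _ ≤ (∫ x, Real.exp (t * m x) ^ (4 : ℝ) ∂ν) ^ (1 / 4 : ℝ) *
          (∫ x, Real.exp (-t * e x) ^ (4 / 3 : ℝ) ∂ν) ^ (1 / (4 / 3) : ℝ) :=
        integral_mul_le_Lp_mul_Lq_of_nonneg hconj
          (Filter.Eventually.of_forall fun x => (Real.exp_pos _).le)
          (Filter.Eventually.of_forall fun x => (Real.exp_pos _).le)
          (hmem hm hmC _ _) (hmem hem heC _ _)
    _ ≤ Real.exp (4 * t * ∫ x, m x ∂ν + (4 * t) ^ 2 / 8 * ∑ i, δ i ^ 2) ^ (1 / 4 : ℝ) *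
          Real.exp (-(4 / 3 * t * ∫ x, e x ∂ν) + (4 / 3 * t) ^ 2 * (∫ x, K x ^ 2 ∂ν) / 2) ^
            (1 / (4 / 3) : ℝ) := by
        gcongr
    _ = Real.exp (t * (∫ x, m x ∂ν - ∫ x, e x ∂ν) +
          t ^ 2 * ((∑ i, δ i ^ 2) / 2 + 2 / 3 * ∫ x, K x ^ 2 ∂ν)) := by
        rw [hexp_rpow, hexp_rpow, ← Real.exp_add]
        congr 1
        ring
    _ ≤ _ := by
        gcongr

/-! ### Tensorization over independent blocks -/

open Classical in
/-- The exponential inequality for `N` independent blocks of `n` sites each. Fixing the first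
block, the induction hypothesis for the remaining ones bounds the partial log-Laplace transform of
`G` at one value of the first block by the data at any other value; this is the hypothesis of the
inequality for one block. -/
theorem integral_exp_le_of_blocks {A : Type*} [MeasurableSpace A] (ϱ : Measure A)
    [IsProbabilityMeasure ϱ] {n N : ℕ} {G g : (Fin N → Fin n → A) → ℝ}
    {K : Fin N → (Fin N → Fin n → A) → ℝ} (hG : Measurable G) (hg : Measurable g)
    (hK : ∀ b, Measurable (K b)) (hGC : ∃ C, ∀ x, |G x| ≤ C) (hgC : ∃ C, ∀ x, |g x| ≤ C)
    (hKC : ∃ C, ∀ b x, |K b x| ≤ C) (hK0 : ∀ b x, 0 ≤ K b x) {δ : Fin N → Fin n → ℝ}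
    (hδ : ∀ b i, 0 ≤ δ b i)
    (h : ∀ x y, G y ≤ g x + ∑ b, if x b ≠ y b then
      (∑ i, if x b i ≠ y b i then δ b i else 0) + K b x else 0)
    {t : ℝ} (ht : 0 < t) :
    ∫ x, Real.exp (t * G x) ∂(Measure.pi fun _ => Measure.pi fun _ => ϱ) ≤
      Real.exp (t * ∫ x, g x ∂(Measure.pi fun _ => Measure.pi fun _ => ϱ) +
        t ^ 2 * ((∑ b, ∑ i, δ b i ^ 2) / 2 +
          2 / 3 * ∑ b, ∫ x, K b x ^ 2 ∂(Measure.pi fun _ => Measure.pi fun _ => ϱ))) := by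
  set μ : Measure (Fin n → A) := Measure.pi fun _ => ϱ with hμ
  induction N with
  | zero =>
    have hdirac : Measure.pi (fun _ : Fin 0 => μ) = Measure.dirac (fun i => i.elim0) :=
      Measure.pi_of_empty _ _
    rw [hdirac, integral_dirac, integral_dirac]
    simp only [Finset.univ_eq_empty, Finset.sum_empty, zero_div, mul_zero, add_zero]
    have := h (fun i => i.elim0) (fun i => i.elim0)
    simp only [Finset.univ_eq_empty, Finset.sum_empty, add_zero] at this
    gcongr
  | succ N ih =>
    obtain ⟨C₁, hGC⟩ := hGC
    obtain ⟨C₂, hgC⟩ := hgC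
    obtain ⟨C₃, hKC⟩ := hKC
    have hKsqC : ∀ b x, |K b x ^ 2| ≤ C₃ ^ 2 := fun b x => by
      rw [abs_pow]
      exact pow_le_pow_left₀ (abs_nonneg _) (hKC b x) 2
    set ν : Measure (Fin N → Fin n → A) := Measure.pi fun _ => μ with hν
    have hcons : ∀ x₀ : Fin n → A, Measurable fun x' : Fin N → Fin n → A =>
        (Fin.cons x₀ x' : Fin (N + 1) → Fin n → A) := fun x₀ =>
      measurable_cons.comp measurable_prodMk_left
    have hmeas : ∀ {F : (Fin (N + 1) → Fin n → A) → ℝ}, Measurable F →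
        Measurable fun x₀ => ∫ x', F (Fin.cons x₀ x') ∂ν := fun {F} hF =>
      (StronglyMeasurable.integral_prod_right (f := fun a y => F (Fin.cons a y))
        (hF.comp measurable_cons).stronglyMeasurable).measurable
    have hint : ∀ {F : (Fin (N + 1) → Fin n → A) → ℝ} (_ : Measurable F) {C : ℝ}
        (_ : ∀ x, |F x| ≤ C) (x₀ : Fin n → A), Integrable (fun x' => F (Fin.cons x₀ x')) ν :=
      fun {F} hF {C} hC x₀ => integrable_of_abs_le (hF.comp (hcons x₀)) fun x' => hC _
    have hsq : ∀ b, Measurable fun x => K b x ^ 2 := fun b => (hK b).pow_const 2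
    -- the partial log-Laplace transform of `G` given the first block, and the data of the induction
    -- hypothesis as functions of the first block
    set G' : (Fin n → A) → ℝ := fun y₀ =>
      t⁻¹ * Real.log (∫ y', Real.exp (t * G (Fin.cons y₀ y')) ∂ν) with hG'
    set R : (Fin n → A) → ℝ := fun x₀ => t * ((∑ b : Fin N, ∑ i, δ b.succ i ^ 2) / 2 +
      2 / 3 * ∑ b : Fin N, ∫ x', K b.succ (Fin.cons x₀ x') ^ 2 ∂ν) with hR
    set g' : (Fin n → A) → ℝ := fun x₀ => ∫ x', g (Fin.cons x₀ x') ∂ν + R x₀ with hg'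
    set K' : (Fin n → A) → ℝ := fun x₀ => ∫ x', K 0 (Fin.cons x₀ x') ∂ν with hK'
    have hexpG : Measurable fun x => Real.exp (t * G x) := by fun_prop
    have hpos : ∀ y₀, 0 < ∫ y', Real.exp (t * G (Fin.cons y₀ y')) ∂ν := fun y₀ =>
      integral_exp_pos (integrable_exp_of_abs_le (hG.comp (hcons y₀)) (fun y' => hGC _) t)
    have hexpG' : ∀ y₀, Real.exp (t * G' y₀) = ∫ y', Real.exp (t * G (Fin.cons y₀ y')) ∂ν := by
      intro y₀
      simp only [hG']
      rw [mul_inv_cancel_left₀ ht.ne', Real.exp_log (hpos y₀)]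
    have hG'm : Measurable G' := (Real.measurable_log.comp (hmeas hexpG)).const_mul _
    have hSm : ∀ b, Measurable fun x₀ => ∫ x', K b (Fin.cons x₀ x') ^ 2 ∂ν := fun b =>
      hmeas (hsq b)
    have hRm : Measurable R := by
      refine Measurable.const_mul (Measurable.const_add (Measurable.const_mul ?_ _) _) _
      exact Finset.measurable_sum _ fun b _ => hSm b.succ
    have hg'm : Measurable g' := (hmeas hg).add hRm
    have hK'm : Measurable K' := hmeas (hK 0)
    have hG'C : ∀ y₀, |G' y₀| ≤ C₁ := by
      intro y₀
      have hb : ∀ y', |t * G (Fin.cons y₀ y')| ≤ t * C₁ := fun y' => by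
        rw [abs_mul, abs_of_pos ht]
        gcongr
        exact hGC _
      have hi := integrable_exp_of_abs_le (μ := ν) (hG.comp (hcons y₀)) (fun y' => hGC _) t
      have hup : ∫ y', Real.exp (t * G (Fin.cons y₀ y')) ∂ν ≤ Real.exp (t * C₁) := by
        have := integral_mono (μ := ν) hi (integrable_const (Real.exp (t * C₁))) fun y' =>
          Real.exp_le_exp.2 (abs_le.1 (hb y')).2
        simpa using this
      have hlo : Real.exp (-(t * C₁)) ≤ ∫ y', Real.exp (t * G (Fin.cons y₀ y')) ∂ν := by
        have := integral_mono (μ := ν) (integrable_const (Real.exp (-(t * C₁)))) hi fun y' =>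
          Real.exp_le_exp.2 (abs_le.1 (hb y')).1
        simpa using this
      rw [← hexpG', Real.exp_le_exp] at hup hlo
      exact abs_le.2 ⟨by nlinarith, by nlinarith⟩
    have hK'0 : ∀ x₀, 0 ≤ K' x₀ := fun x₀ => integral_nonneg fun x' => hK0 _ _
    have hK'C : ∀ x₀, |K' x₀| ≤ C₃ := fun x₀ => abs_integral_le_of_abs_le fun x' => hKC _ _
    have hSC : ∀ b x₀, |∫ x', K b (Fin.cons x₀ x') ^ 2 ∂ν| ≤ C₃ ^ 2 := fun b x₀ =>
      abs_integral_le_of_abs_le fun x' => hKsqC _ _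
    have hRC : ∀ x₀, |R x₀| ≤ t * ((∑ b : Fin N, ∑ i, δ b.succ i ^ 2) / 2 +
        2 / 3 * ∑ _b : Fin N, C₃ ^ 2) := by
      intro x₀
      have h0 : 0 ≤ ∑ b : Fin N, ∫ x', K b.succ (Fin.cons x₀ x') ^ 2 ∂ν :=
        Finset.sum_nonneg fun b _ => integral_nonneg fun x' => sq_nonneg _
      have h1 : 0 ≤ ∑ b : Fin N, ∑ i, δ b.succ i ^ 2 :=
        Finset.sum_nonneg fun b _ => Finset.sum_nonneg fun i _ => sq_nonneg _
      have hle : ∑ b : Fin N, ∫ x', K b.succ (Fin.cons x₀ x') ^ 2 ∂ν ≤ ∑ _b : Fin N, C₃ ^ 2 :=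
        Finset.sum_le_sum fun b _ => (le_abs_self _).trans (hSC _ _)
      rw [abs_of_nonneg (by positivity)]
      simp only [hR]
      gcongr
    have hg'C : ∀ x₀, |g' x₀| ≤ C₂ + t * ((∑ b : Fin N, ∑ i, δ b.succ i ^ 2) / 2 +
        2 / 3 * ∑ _b : Fin N, C₃ ^ 2) := fun x₀ =>
      (abs_add_le _ _).trans (add_le_add (abs_integral_le_of_abs_le fun x' => hgC _) (hRC x₀))
    -- the partial log-Laplace transforms satisfy the hypothesis of the one-block inequality
    have hcross : ∀ x₀ y₀, G' y₀ ≤ g' x₀ + if x₀ ≠ y₀ then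
        (∑ i, if x₀ i ≠ y₀ i then δ 0 i else 0) + K' x₀ else 0 := by
      intro x₀ y₀
      set D : ℝ := ∑ i, if x₀ i ≠ y₀ i then δ 0 i else 0
      have hi := ih (G := fun y' => G (Fin.cons y₀ y'))
        (g := fun x' => g (Fin.cons x₀ x') + if x₀ ≠ y₀ then D + K 0 (Fin.cons x₀ x') else 0)
        (K := fun b x' => K b.succ (Fin.cons x₀ x')) (δ := fun b => δ b.succ)
        (hG.comp (hcons y₀)) ((hg.comp (hcons x₀)).add (by
          split_ifs
          · exact ((hK 0).comp (hcons x₀)).const_add _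
          · exact measurable_const)) (fun b => (hK b.succ).comp (hcons x₀))
        ⟨C₁, fun _ => hGC _⟩ ⟨C₂ + (|D| + C₃), fun x' => (abs_add_le _ _).trans
          (add_le_add (hgC _) (by
            have := (abs_nonneg _).trans (hKC 0 (Fin.cons x₀ x'))
            split_ifs
            · exact (abs_add_le _ _).trans (add_le_add le_rfl (hKC _ _))
            · simp only [abs_zero]
              positivity))⟩
        ⟨C₃, fun _ _ => hKC _ _⟩ (fun _ _ => hK0 _ _) (fun _ _ => hδ _ _) (by
          intro x' y'
          have := h (Fin.cons x₀ x') (Fin.cons y₀ y')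
          rw [Fin.sum_univ_succ] at this
          simp only [Fin.cons_zero, Fin.cons_succ] at this
          rw [add_assoc]
          exact this)
      rw [← hexpG', Real.exp_le_exp] at hi
      have hsplit : ∫ x', (g (Fin.cons x₀ x') + if x₀ ≠ y₀ then D + K 0 (Fin.cons x₀ x') else 0) ∂ν
          = ∫ x', g (Fin.cons x₀ x') ∂ν + if x₀ ≠ y₀ then D + K' x₀ else 0 := by
        split_ifs
        · have hi2 : Integrable (fun x' => D + K 0 (Fin.cons x₀ x')) ν :=
            (integrable_const _).add (hint (hK 0) (hKC 0) x₀)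
          rw [integral_add (hint hg hgC x₀) hi2,
            integral_add (integrable_const _) (hint (hK 0) (hKC 0) x₀)]
          simp [hK']
        · simp
      rw [hsplit] at hi
      have : t * G' y₀ ≤ t * (g' x₀ + if x₀ ≠ y₀ then D + K' x₀ else 0) := by
        refine hi.trans (le_of_eq ?_)
        simp only [hg', hR]
        ring
      exact le_of_mul_le_mul_left this ht
    set C := C₁ + (C₂ + t * ((∑ b : Fin N, ∑ i, δ b.succ i ^ 2) / 2 +
        2 / 3 * ∑ _b : Fin N, C₃ ^ 2)) + C₃
    have hne : Nonempty (Fin n → A) := nonempty_of_isProbabilityMeasure μ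
    have hx₀ : Fin n → A := hne.some
    have h1 := (abs_nonneg _).trans (hG'C hx₀)
    have h2 := (abs_nonneg _).trans (hg'C hx₀)
    have h3 := (abs_nonneg _).trans (hK'C hx₀)
    have hblock := integral_exp_le_of_block ϱ hG'm hg'm hK'm (C := C)
      (fun x => (hG'C x).trans (by simp only [C]; linarith))
      (fun x => (hg'C x).trans (by simp only [C]; linarith))
      (fun x => (hK'C x).trans (by simp only [C]; linarith)) hK'0 (hδ 0) hcross ht
    rw [← hμ] at hblock
    rw [integral_pi_succ μ _ (integrable_exp_of_abs_le hG hGC t)]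
    simp_rw [hexpG'] at hblock
    refine hblock.trans (Real.exp_le_exp.2 ?_)
    -- Jensen's inequality for the conditional mean of `K 0`
    have hjensen : ∫ x₀, K' x₀ ^ 2 ∂μ ≤ ∫ x₀, ∫ x', K 0 (Fin.cons x₀ x') ^ 2 ∂ν ∂μ := by
      refine integral_mono (integrable_of_abs_le (hK'm.pow_const 2) (C := C₃ ^ 2) fun x₀ => ?_)
        (integrable_of_abs_le (hSm 0) (hSC 0)) fun x₀ => ?_
      · rw [abs_pow]
        exact pow_le_pow_left₀ (abs_nonneg _) (hK'C x₀) 2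
      · exact (Even.convexOn_pow even_two).map_integral_le
          (by fun_prop) isClosed_univ (by simp) (hint (hK 0) (hKC 0) x₀)
          (hint (hsq 0) (hKsqC 0) x₀)
    have hgint : ∫ x₀, g' x₀ ∂μ = ∫ x, g x ∂(Measure.pi fun _ => μ) +
        t * ((∑ b : Fin N, ∑ i, δ b.succ i ^ 2) / 2 +
          2 / 3 * ∑ b : Fin N, ∫ x, K b.succ x ^ 2 ∂(Measure.pi fun _ => μ)) := by
      rw [integral_pi_succ μ g (integrable_of_abs_le hg hgC)]
      simp_rw [fun b : Fin N => integral_pi_succ μ (fun x => K b.succ x ^ 2)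
        (integrable_of_abs_le (hsq _) (hKsqC _))]
      have hSi : ∀ b : Fin N, Integrable
          (fun x₀ => ∫ x', K b.succ (Fin.cons x₀ x') ^ 2 ∂ν) μ := fun b =>
        integrable_of_abs_le (hSm _) (hSC _)
      simp only [hg']
      rw [integral_add (integrable_of_abs_le (hmeas hg) fun x₀ =>
        abs_integral_le_of_abs_le fun x' => hgC _) (integrable_of_abs_le hRm hRC)]
      simp only [hR]
      rw [integral_const_mul, integral_add (integrable_const _)
        ((integrable_finsetSum _ fun b _ => hSi b).const_mul _), integral_const_mul,
        integral_finsetSum _ fun b _ => hSi b]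
      simp
      rfl
    rw [hgint, Fin.sum_univ_succ, Fin.sum_univ_succ (f := fun b => ∫ x, K b x ^ 2 ∂_),
      integral_pi_succ μ (fun x => K 0 x ^ 2) (integrable_of_abs_le (hsq _) (hKsqC _))]
    have ht2 : 0 ≤ t ^ 2 := by positivity
    nlinarith [mul_le_mul_of_nonneg_left hjensen ht2]

/-! ### Universal measurability of analytic sets -/

open Filter Topology in
/-- If the sequences in an open set `V` include all those bounded by `n`, then `V` already contains
all sequences whose first `k` terms are bounded by `n`, for some `k`. -/
theorem exists_prefix_subset_of_isOpen (n : ℕ → ℕ) {V : Set (ℕ → ℕ)} (hV : IsOpen V)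
    (hnV : {x | ∀ i, x i ≤ n i} ⊆ V) : ∃ k, {x : ℕ → ℕ | ∀ i < k, x i ≤ n i} ⊆ V := by
  by_contra! h
  simp only [Set.not_subset, Set.mem_ofPred_eq] at h
  choose x hx hxV using h
  have hK : IsCompact (Set.univ.pi fun i => Set.Iic (n i)) :=
    isCompact_univ_pi fun i => (Set.finite_Iic (n i)).isCompact
  obtain ⟨a, ha, ψ, hψ, hlim⟩ := hK.tendsto_subseq
    (x := fun k i => if i < k then x k i else 0) (fun k i _ => by
      simp only [Set.mem_Iic]
      split_ifs with hi
      exacts [hx k i hi, Nat.zero_le _])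
  -- each coordinate of `x k` is eventually that of its truncation, so both have the same limit
  have hlim' : Tendsto (x ∘ ψ) atTop (𝓝 a) := by
    rw [tendsto_pi_nhds] at hlim ⊢
    intro i
    refine (hlim i).congr' ?_
    filter_upwards [eventually_gt_atTop i] with k hk
    simp [hk.trans_le (hψ.id_le k)]
  have : a ∈ Vᶜ := hV.isClosed_compl.mem_of_tendsto hlim'
    (Eventually.of_forall fun k => hxV (ψ k))
  exact this (hnV fun i => ha i trivial)

/-- Inner regularity of analytic sets with respect to compact sets, for the outer measure. -/
theorem exists_isCompact_subset_range_lt {S : Type*} [TopologicalSpace S] [T2Space S]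
    [MeasurableSpace S] (μ : Measure S) [μ.OuterRegular] {F : (ℕ → ℕ) → S} (hF : Continuous F)
    {c : ℝ≥0∞} (hc : c < μ (Set.range F)) : ∃ K ⊆ Set.range F, IsCompact K ∧ c ≤ μ K := by
  have hstep : ∀ (k : ℕ) (E : {E : Set (ℕ → ℕ) // c < μ (F '' E)}),
      ∃ m : ℕ, c < μ (F '' (E.1 ∩ {x | x k ≤ m})) := by
    rintro k ⟨E, hE⟩
    have hU : F '' E = ⋃ m : ℕ, F '' (E ∩ {x | x k ≤ m}) := by
      rw [← Set.image_iUnion, ← Set.inter_iUnion]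
      congr 1
      ext x
      simp only [Set.mem_inter_iff, Set.mem_iUnion, Set.mem_ofPred_eq, iff_self_and]
      exact fun _ => ⟨x k, le_rfl⟩
    have hmono : Monotone fun m : ℕ => F '' (E ∩ {x | x k ≤ m}) := fun a b hab =>
      Set.image_mono (Set.inter_subset_inter_right _ fun x hx => le_trans hx hab)
    rw [hU, hmono.measure_iUnion] at hE
    exact lt_iSup_iff.1 hE
  choose m hm using hstep
  -- bounds for the successive terms of the sequences, losing nothing below `c` in the image
  let E : ℕ → {E : Set (ℕ → ℕ) // c < μ (F '' E)} := fun k =>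
    Nat.rec ⟨Set.univ, by rwa [Set.image_univ]⟩
      (fun k E => ⟨E.1 ∩ {x | x k ≤ m k E}, hm k E⟩) k
  set n : ℕ → ℕ := fun k => m k (E k) with hn
  have hE : ∀ k, (E k).1 = {x | ∀ i < k, x i ≤ n i} := by
    intro k
    induction k with
    | zero => simp [E]
    | succ k ih =>
      have : (E (k + 1)).1 = (E k).1 ∩ {x | x k ≤ n k} := rfl
      rw [this, ih]
      ext x
      simp only [Set.mem_inter_iff, Set.mem_ofPred_eq, Nat.lt_succ_iff_lt_or_eq]
      constructor
      · rintro ⟨h1, h2⟩ i (hi | rfl)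
        exacts [h1 i hi, h2]
      · exact fun h => ⟨fun i hi => h i (Or.inl hi), h k (Or.inr rfl)⟩
  have hK : IsCompact {x : ℕ → ℕ | ∀ i, x i ≤ n i} := by
    have : {x : ℕ → ℕ | ∀ i, x i ≤ n i} = Set.univ.pi fun i => Set.Iic (n i) := by
      ext x
      simp [Pi.le_def]
    rw [this]
    exact isCompact_univ_pi fun i => (Set.finite_Iic (n i)).isCompact
  refine ⟨F '' {x | ∀ i, x i ≤ n i}, Set.image_subset_range _ _, hK.image hF, ?_⟩
  -- by outer regularity it suffices to look at open sets around the compact image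
  rw [Set.measure_eq_iInf_isOpen]
  refine le_iInf₂ fun U hU => le_iInf fun hUo => ?_
  obtain ⟨k, hk⟩ := exists_prefix_subset_of_isOpen n (hUo.preimage hF) (Set.image_subset_iff.1 hU)
  rw [← hE] at hk
  exact (E k).2.le.trans (measure_mono (Set.image_subset_iff.2 hk))

/-- Analytic sets are universally measurable. -/
theorem nullMeasurableSet_of_analyticSet {S : Type*} [TopologicalSpace S] [T2Space S]
    [MeasurableSpace S] [BorelSpace S] (μ : Measure S) [IsFiniteMeasure μ] [μ.OuterRegular]
    {s : Set S} (hs : AnalyticSet s) : NullMeasurableSet s μ := by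
  rw [AnalyticSet] at hs
  rcases hs with rfl | ⟨F, hF, rfl⟩
  · exact nullMeasurableSet_empty
  rcases eq_or_ne (μ (Set.range F)) 0 with h0 | h0
  · exact NullMeasurableSet.of_null h0
  obtain ⟨u, -, hu, hulim⟩ := exists_seq_strictMono_tendsto' (pos_iff_ne_zero.2 h0)
  choose K hKs hK huK using fun j =>
    exists_isCompact_subset_range_lt μ hF (hu j).2
  have hL : MeasurableSet (⋃ j, K j) := MeasurableSet.iUnion fun j => (hK j).measurableSet
  have hLs : ⋃ j, K j ⊆ Set.range F := Set.iUnion_subset hKs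
  have hle : μ (toMeasurable μ (Set.range F)) ≤ μ (⋃ j, K j) := by
    rw [measure_toMeasurable]
    exact le_of_tendsto' hulim fun j => (huK j).trans (measure_mono (Set.subset_iUnion K j))
  have hae : (⋃ j, K j : Set S) =ᵐ[μ] toMeasurable μ (Set.range F) :=
    ae_eq_of_subset_of_measure_ge (hLs.trans (subset_toMeasurable _ _)) hle
      hL.nullMeasurableSet (measure_ne_top _ _)
  refine ⟨_, measurableSet_toMeasurable μ (Set.range F), ?_⟩
  exact (subset_toMeasurable _ _).eventuallyLE.antisymm
    (hae.symm.le.trans hLs.eventuallyLE)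

/-- The image of a measurable set under a measurable map between standard Borel spaces is measurable
for the completion of every finite measure. -/
theorem nullMeasurableSet_image {S T : Type*} [MeasurableSpace S] [StandardBorelSpace S]
    [MeasurableSpace T] [StandardBorelSpace T] (μ : Measure T) [IsFiniteMeasure μ] {F : S → T}
    (hF : Measurable F) {s : Set S} (hs : MeasurableSet s) : NullMeasurableSet (F '' s) μ := by
  let := upgradeStandardBorel T
  exact nullMeasurableSet_of_analyticSet μ (hs.analyticSet_image hF)

/-! ### A Borel version of the coding radius -/

section Radius

variable {d : ℕ} {A B : Type*}

theorem codingRadius_le_iff (φ : (Lattice d → A) → (Lattice d → B)) (x : Lattice d → A) (n : ℕ) :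
    codingRadius φ x ≤ n ↔ ∀ x' : Lattice d → A,
      (∀ i ∈ Metric.closedBall (0 : Lattice d) (n : ℝ), x' i = x i) → φ x' 0 = φ x 0 := by
  constructor
  · intro h x' hx'
    have hlt : codingRadius φ x < ((n + 1 : ℕ) : ℕ∞) :=
      h.trans_lt (by exact_mod_cast Nat.lt_succ_self n)
    rw [codingRadius, iInf_lt_iff] at hlt
    obtain ⟨r, hr⟩ := hlt
    rw [iInf_lt_iff] at hr
    obtain ⟨hdet, hr⟩ := hr
    have hrn : r ≤ n := Nat.lt_succ_iff.1 (by exact_mod_cast hr)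
    exact hdet x' fun i hi => hx' i (Metric.closedBall_subset_closedBall (by exact_mod_cast hrn) hi)
  · intro h
    exact iInf₂_le n h

/-- The coding radius agrees almost everywhere with a Borel function that dominates it and is itself
a stopping radius: whether it is at most `n` is decided by the coordinates in the ball of radius
`n`. The set where the radius exceeds `n` is the inverse image, under the restriction to this ball,
of an analytic set, and analytic sets are measurable up to null sets. -/
theorem exists_measurable_radius [MeasurableSpace A] [StandardBorelSpace A] [MeasurableSpace B]
    [StandardBorelSpace B] (μ : Measure (Lattice d → A)) [IsFiniteMeasure μ]
    {φ : (Lattice d → A) → (Lattice d → B)} (hφ : Measurable φ) :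
    ∃ ρ : (Lattice d → A) → ℕ∞, (∀ n : ℕ, MeasurableSet {x | ρ x ≤ n}) ∧
      (∀ x, codingRadius φ x ≤ ρ x) ∧
      (∀ (x x' : Lattice d → A) (n : ℕ),
        (∀ i ∈ Metric.closedBall (0 : Lattice d) (n : ℝ), x' i = x i) → ρ x ≤ n → ρ x' ≤ n) ∧
      ρ =ᵐ[μ] codingRadius φ := by
  let π : ∀ n : ℕ, (Lattice d → A) → (Metric.closedBall (0 : Lattice d) (n : ℝ) → A) :=
    fun n x i => x i
  have hπ : ∀ n, Measurable (π n) := fun n => by fun_prop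
  -- `U n` consists of the patterns in the ball of radius `n` that leave the symbol at `0` open
  let D : ℕ → Set ((Lattice d → A) × (Lattice d → A)) := fun n =>
    {p | π n p.1 = π n p.2 ∧ φ p.1 0 ≠ φ p.2 0}
  have hD : ∀ n, MeasurableSet (D n) := fun n => by
    refine (measurableSet_eq_fun ((hπ n).comp measurable_fst) ((hπ n).comp measurable_snd)).inter ?_
    exact (measurableSet_eq_fun ((measurable_pi_apply 0).comp (hφ.comp measurable_fst))
      ((measurable_pi_apply 0).comp (hφ.comp measurable_snd))).compl
  let U : ∀ n : ℕ, Set (Metric.closedBall (0 : Lattice d) (n : ℝ) → A) := fun n =>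
    (fun p : (Lattice d → A) × (Lattice d → A) => π n p.1) '' D n
  have hU : ∀ n, NullMeasurableSet (U n) (μ.map (π n)) := fun n =>
    nullMeasurableSet_image _ ((hπ n).comp measurable_fst) (hD n)
  have hrU : ∀ n x, π n x ∈ U n ↔ ¬ codingRadius φ x ≤ n := by
    intro n x
    rw [codingRadius_le_iff]
    push Not
    constructor
    · rintro ⟨⟨x₁, x₂⟩, ⟨h12, hne⟩, h1⟩
      simp only at h12 hne h1
      by_cases h : φ x₁ 0 = φ x 0
      · exact ⟨x₂, fun i hi => congrFun (h12.symm.trans h1) ⟨i, hi⟩,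
          fun h2 => hne (h.trans h2.symm)⟩
      · exact ⟨x₁, fun i hi => congrFun h1 ⟨i, hi⟩, h⟩
    · rintro ⟨x', hx', hne⟩
      exact ⟨(x, x'), ⟨funext fun i => (hx' i i.2).symm, fun h => hne h.symm⟩, rfl⟩
  choose H hUH hH hHU using fun n => (hU n).exists_measurable_superset_ae_eq
  -- the first `n` such that the pattern avoids a Borel hull of `U n`
  refine ⟨fun x => ⨅ (n : ℕ) (_ : π n x ∉ H n), (n : ℕ∞), fun n => ?_, fun x => ?_, ?_, ?_⟩
  · have hset : {x : Lattice d → A | (⨅ (m : ℕ) (_ : π m x ∉ H m), (m : ℕ∞)) ≤ n} =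
        ⋃ m ∈ Set.Iic n, (π m ⁻¹' H m)ᶜ := by
      ext x
      simp only [Set.mem_ofPred_eq, Set.mem_iUnion, Set.mem_compl_iff, Set.mem_preimage,
        Set.mem_Iic, exists_prop]
      constructor
      · intro h
        have hlt := h.trans_lt
          (by exact_mod_cast Nat.lt_succ_self n : (n : ℕ∞) < ((n + 1 : ℕ) : ℕ∞))
        obtain ⟨m, hm⟩ := iInf_lt_iff.1 hlt
        obtain ⟨hm, hmn⟩ := iInf_lt_iff.1 hm
        exact ⟨m, Nat.lt_succ_iff.1 (by exact_mod_cast hmn), hm⟩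
      · rintro ⟨m, hmn, hm⟩
        exact (iInf₂_le m hm).trans (by exact_mod_cast hmn)
    rw [hset]
    exact MeasurableSet.biUnion (Set.to_countable _) fun m _ => ((hH m).preimage (hπ m)).compl
  · refine le_iInf₂ fun n hn => ?_
    by_contra h
    exact hn (hUH n ((hrU n x).2 h))
  · intro x x' n hx h
    have hlt := h.trans_lt (by exact_mod_cast Nat.lt_succ_self n : (n : ℕ∞) < ((n + 1 : ℕ) : ℕ∞))
    obtain ⟨m, hm⟩ := iInf_lt_iff.1 hlt
    obtain ⟨hm, hmn⟩ := iInf_lt_iff.1 hm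
    have hmn' : m ≤ n := Nat.lt_succ_iff.1 (by exact_mod_cast hmn)
    have hπx : π m x' = π m x := funext fun i =>
      hx i (Metric.closedBall_subset_closedBall (by exact_mod_cast hmn') i.2)
    exact (iInf₂_le m (by rwa [hπx])).trans (by exact_mod_cast hmn')
  · have hae : ∀ᵐ x ∂μ, ∀ n, (π n x ∈ H n ↔ π n x ∈ U n) := by
      rw [ae_all_iff]
      intro n
      have h1 := ae_of_ae_map (hπ n).aemeasurable (hHU n)
      filter_upwards [h1] with x hx
      exact iff_of_eq hx
    filter_upwards [hae] with x hx
    refine le_antisymm ?_ (le_iInf₂ fun n hn => ?_)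
    · induction hc : codingRadius φ x using ENat.recTopCoe with
      | top => exact le_top
      | coe n => exact iInf₂_le n fun h => (hrU n x).1 ((hx n).1 h) hc.le
    · by_contra h
      exact hn (hUH n ((hrU n x).2 h))

end Radius

/-! ### Cubes of side four and increments of a coded function -/

section Grid

variable {d : ℕ} {A B : Type*}

/-- The distance at which a coding radius at `v` is felt by the cube `{0, 1, 2, 3}^d`: the least
`k ≥ 1` with `v ∈ [-k, k + 3]^d`. -/
def cubeDist (v : Lattice d) : ℕ :=
  max 1 (Finset.univ.sup fun m => max (-v m).toNat (v m - 3).toNat)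

theorem one_le_cubeDist (v : Lattice d) : 1 ≤ cubeDist v := le_max_left _ _

theorem cubeDist_le_iff {v : Lattice d} {k : ℕ} (hk : 1 ≤ k) :
    cubeDist v ≤ k ↔ ∀ m, -(k : ℤ) ≤ v m ∧ v m ≤ k + 3 := by
  simp only [cubeDist, max_le_iff, Finset.sup_le_iff, Finset.mem_univ, true_imp_iff, hk, true_and]
  refine forall_congr' fun m => ?_
  omega

/-- A bound by `δ` on all one-site increments adds up to a bound on arbitrary increments. -/
theorem le_add_sum_of_dependsOn [DecidableEq (Lattice d)] {f : (Lattice d → B) → ℝ}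
    {Λ : Finset (Lattice d)} (hf : DependsOn f (Λ : Set (Lattice d))) {δ : Lattice d → ℝ}
    (hδ : ∀ j y b, f (Function.update y j b) ≤ f y + δ j) (y y' : Lattice d → B)
    [∀ j, Decidable (y j ≠ y' j)] :
    f y' ≤ f y + ∑ j ∈ Λ, if y j ≠ y' j then δ j else 0 := by
  have key : ∀ s : Finset (Lattice d), f (s.piecewise y' y) ≤
      f y + ∑ j ∈ s, if y j ≠ y' j then δ j else 0 := by
    intro s
    induction s using Finset.induction_on with
    | empty => simp
    | insert j s hj ih =>
      rw [Finset.piecewise_insert, Finset.sum_insert hj]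
      by_cases h : y j = y' j
      · have : Function.update (s.piecewise y' y) j (y' j) = s.piecewise y' y := by
          rw [← h]
          conv_rhs => rw [← Function.update_eq_self j (s.piecewise y' y)]
          rw [Finset.piecewise_eq_of_notMem _ _ _ hj]
        rw [this]
        simpa [h] using ih
      · have := hδ j (s.piecewise y' y) (y' j)
        simp only [ne_eq, h, not_false_eq_true, if_true]
        simp only [ne_eq] at ih
        linarith
  refine le_trans (le_of_eq ?_) (key Λ)
  exact hf fun j hj => (Finset.piecewise_eq_of_mem _ _ _ hj).symm

/-- The joint law of finitely many disjoint blocks of sites in an i.i.d. field. -/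
theorem map_blocks_eq_pi {Ω : Type*} [MeasurableSpace Ω] [MeasurableSpace A] {P : Measure Ω}
    [IsProbabilityMeasure P] {ϱ : Measure A} [IsProbabilityMeasure ϱ] {X : Ω → Lattice d → A}
    (hX : IsIIDField P ϱ X) {N n : ℕ} {site : Fin N → Fin n → Lattice d}
    (hsite : Function.Injective (Function.uncurry site)) :
    P.map (fun ω b i => X ω (site b i)) = Measure.pi fun _ => Measure.pi fun _ => ϱ := by
  have h1 := (hX.indep.precomp hsite)
  rw [iIndepFun_iff_map_fun_eq_infinitePi_map (fun p => hX.measurable _)] at h1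
  simp_rw [hX.law] at h1
  have h2 := Measure.infinitePi_map_curry (fun (_ : Fin N) (_ : Fin n) => ϱ)
  simp_rw [Measure.infinitePi_eq_pi] at h2
  rw [← h2, ← Measure.infinitePi_eq_pi, ← h1,
    Measure.map_map (MeasurableEquiv.measurable _)
      (measurable_pi_lambda _ fun p => hX.measurable _)]
  rfl

/-- If two configurations give different values at `j`, they differ at a site within the radius. -/
theorem exists_ne_of_ne {R : (Lattice d → A) → ℕ} {Y : (Lattice d → A) → B}
    (hdet : ∀ x x' : Lattice d → A, (∀ i, (∀ m, |i m| ≤ (R x : ℤ)) → x' i = x i) →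
      R x' = R x ∧ Y x' = Y x)
    {x x' : Lattice d → A} {j : Lattice d} (h : Y (shift j x) ≠ Y (shift j x')) :
    ∃ p, (∀ m, |p m - j m| ≤ R (shift j x)) ∧ x p ≠ x' p := by
  by_contra! hc
  refine h (hdet (shift j x) (shift j x') fun i hi => ?_).2.symm
  refine (hc (i + j) fun m => ?_).symm
  simpa using hi m

theorem measurable_shift [MeasurableSpace A] (j : Lattice d) :
    Measurable (shift j : (Lattice d → A) → (Lattice d → A)) :=
  measurable_pi_lambda _ fun _ => measurable_pi_apply _

open Classical in
/-- The total oscillation of the sites `j ∈ Λ` whose radius reaches the cube `u + {0, 1, 2, 3}^d`.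
Sites with radius zero do not count, because `cubeDist` is at least `1`. -/
noncomputable def reach (Λ : Finset (Lattice d)) (δ : Lattice d → ℝ) (R : (Lattice d → A) → ℕ)
    (u : Lattice d) (x : Lattice d → A) : ℝ :=
  ∑ j ∈ Λ, if cubeDist (j - u) ≤ R (shift j x) then δ j else 0

theorem measurable_reach [MeasurableSpace A] (Λ : Finset (Lattice d)) (δ : Lattice d → ℝ)
    {R : (Lattice d → A) → ℕ} (hR : Measurable R) (u : Lattice d) : Measurable (reach Λ δ R u) := by
  classical
  refine Finset.measurable_sum _ fun j _ => Measurable.ite ?_ measurable_const measurable_const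
  exact measurableSet_le measurable_const (hR.comp (measurable_shift j))

theorem reach_nonneg {Λ : Finset (Lattice d)} {δ : Lattice d → ℝ} (hδ : ∀ j, 0 ≤ δ j)
    (R : (Lattice d → A) → ℕ) (u : Lattice d) (x : Lattice d → A) : 0 ≤ reach Λ δ R u x :=
  Finset.sum_nonneg fun j _ => by split_ifs <;> simp [hδ j]

theorem reach_le {Λ : Finset (Lattice d)} {δ : Lattice d → ℝ} (hδ : ∀ j, 0 ≤ δ j)
    (R : (Lattice d → A) → ℕ) (u : Lattice d) (x : Lattice d → A) :
    reach Λ δ R u x ≤ ∑ j ∈ Λ, δ j :=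
  Finset.sum_le_sum fun j _ => by split_ifs <;> simp [hδ j]

open Classical in
/-- The increment of a function of the coded field, split into the sites that changed and the blocks
that changed. -/
theorem increment_le_sum_blocks {R : (Lattice d → A) → ℕ} {Y : (Lattice d → A) → B}
    (hdet : ∀ x x' : Lattice d → A, (∀ i, (∀ m, |i m| ≤ (R x : ℤ)) → x' i = x i) →
      R x' = R x ∧ Y x' = Y x)
    {Λ : Finset (Lattice d)} {f : (Lattice d → B) → ℝ} {δ : Lattice d → ℝ} (hδ0 : ∀ j, 0 ≤ δ j)
    (hf : ∀ y y', f y' ≤ f y + ∑ j ∈ Λ, if y j ≠ y' j then δ j else 0)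
    {N n : ℕ} {site : Fin N → Fin n → Lattice d} {u : Fin N → Lattice d}
    (hu : ∀ b i m, u b m ≤ site b i m ∧ site b i m ≤ u b m + 3)
    {x x' : Lattice d → A} (hxx' : ∀ p, x p ≠ x' p → ∃ b i, site b i = p) :
    f (fun j => Y (shift j x')) ≤ f (fun j => Y (shift j x)) +
      ∑ b, if (fun i => x (site b i)) ≠ (fun i => x' (site b i)) then
        (∑ i, if x (site b i) ≠ x' (site b i) then δ (site b i) else 0) + reach Λ δ R (u b) x
      else 0 := by
  refine (hf _ _).trans (add_le_add le_rfl ?_)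
  have hblock : ∀ b i, x (site b i) ≠ x' (site b i) →
      (fun i => x (site b i)) ≠ (fun i => x' (site b i)) := fun b i h h' => h (congrFun h' i)
  have hterm : ∀ j ∈ Λ, (if Y (shift j x) ≠ Y (shift j x') then δ j else 0) ≤
      ∑ b, if (fun i => x (site b i)) ≠ (fun i => x' (site b i)) then
        (∑ i, if x (site b i) ≠ x' (site b i) then (if site b i = j then δ j else 0) else 0) +
          (if cubeDist (j - u b) ≤ R (shift j x) then δ j else 0) else 0 := by
    intro j _
    have hin : ∀ b, 0 ≤ ∑ i, if x (site b i) ≠ x' (site b i) then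
        (if site b i = j then δ j else 0) else 0 := fun b => Finset.sum_nonneg fun i _ => by
      split_ifs <;> simp [hδ0 j]
    have hnn : ∀ b, 0 ≤ if (fun i => x (site b i)) ≠ (fun i => x' (site b i)) then
        (∑ i, if x (site b i) ≠ x' (site b i) then (if site b i = j then δ j else 0) else 0) +
          (if cubeDist (j - u b) ≤ R (shift j x) then δ j else 0) else 0 := by
      intro b
      have := hin b
      split_ifs
      · exact add_nonneg this (hδ0 j)
      · exact add_nonneg this le_rfl
      · exact le_rfl
    by_cases hY : Y (shift j x) ≠ Y (shift j x')
    swap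
    · rw [if_neg hY]
      exact Finset.sum_nonneg fun b _ => hnn b
    rw [if_pos hY]
    obtain ⟨p, hp, hpne⟩ := exists_ne_of_ne hdet hY
    obtain ⟨b, i, rfl⟩ := hxx' p hpne
    refine le_trans ?_ (Finset.single_le_sum (fun b _ => hnn b) (Finset.mem_univ b))
    rw [if_pos (hblock b i hpne)]
    -- a site with radius zero has changed itself; otherwise the changed site `p` lies in a changed
    -- cube within reach
    rcases Nat.eq_zero_or_pos (R (shift j x)) with h0 | hpos
    · have hj : site b i = j := by
        funext m
        have := hp m
        rw [h0] at this
        have := abs_le.1 this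
        push_cast at this
        linarith [this.1, this.2]
      have h1 : δ j ≤ ∑ i, if x (site b i) ≠ x' (site b i) then
          (if site b i = j then δ j else 0) else 0 := by
        refine le_trans (le_of_eq ?_) (Finset.single_le_sum (fun i _ => ?_) (Finset.mem_univ i))
        · rw [if_pos hpne, if_pos hj]
        · split_ifs <;> simp [hδ0 j]
      refine h1.trans (le_add_of_nonneg_right ?_)
      split_ifs <;> simp [hδ0 j]
    · have hcube : cubeDist (j - u b) ≤ R (shift j x) := by
        rw [cubeDist_le_iff hpos]
        intro m
        have h1 := abs_le.1 (hp m)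
        have h2 := hu b i m
        simp only [Pi.sub_apply]
        omega
      rw [if_pos hcube]
      exact le_add_of_nonneg_left (hin b)
  refine (Finset.sum_le_sum hterm).trans ?_
  rw [Finset.sum_comm]
  refine Finset.sum_le_sum fun b _ => ?_
  by_cases hb : (fun i => x (site b i)) ≠ (fun i => x' (site b i))
  swap
  · simp only [if_neg hb, Finset.sum_const_zero, le_refl]
  simp only [if_pos hb]
  rw [Finset.sum_add_distrib, Finset.sum_comm]
  refine add_le_add (Finset.sum_le_sum fun i _ => ?_) le_rfl
  by_cases hi : x (site b i) ≠ x' (site b i)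
  swap
  · simp only [if_neg hi, Finset.sum_const_zero, le_refl]
  simp only [if_pos hi]
  rw [Finset.sum_ite_eq]
  split_ifs
  exacts [le_rfl, hδ0 _]

end Grid

/-! ### The exponential inequality along one grid of cubes -/

section Field

variable {d : ℕ} {Ω A B : Type*} [MeasurableSpace Ω] [MeasurableSpace A] [MeasurableSpace B]

open Classical in
/-- The exponential inequality for a function of a coded field, when finitely many disjoint blocks
of sites cover everything that the function depends on. -/
theorem integral_exp_le_of_cover {P : Measure Ω} [IsProbabilityMeasure P] {ϱ : Measure A}
    [IsProbabilityMeasure ϱ] {X : Ω → Lattice d → A} (hX : IsIIDField P ϱ X)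
    {R : (Lattice d → A) → ℕ} {Y : (Lattice d → A) → B} (hR : Measurable R) (hY : Measurable Y)
    {r : ℕ} (hRr : ∀ x, R x ≤ r)
    (hdet : ∀ x x' : Lattice d → A, (∀ i, (∀ m, |i m| ≤ (R x : ℤ)) → x' i = x i) →
      R x' = R x ∧ Y x' = Y x)
    {Λ : Finset (Lattice d)} {f : (Lattice d → B) → ℝ} (hfm : Measurable f)
    (hfC : ∃ C, ∀ y, |f y| ≤ C) {δ : Lattice d → ℝ} (hδ0 : ∀ j, 0 ≤ δ j)
    (hδΛ : ∀ j ∉ Λ, δ j = 0)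
    (hf : ∀ y y', f y' ≤ f y + ∑ j ∈ Λ, if y j ≠ y' j then δ j else 0)
    {N n : ℕ} {site : Fin N → Fin n → Lattice d} {u : Fin N → Lattice d}
    (hsite : Function.Injective (Function.uncurry site))
    (hu : ∀ b i m, u b m ≤ site b i m ∧ site b i m ≤ u b m + 3)
    (hcover : ∀ j ∈ Λ, ∀ p : Lattice d, (∀ m, |p m - j m| ≤ (r : ℤ)) → ∃ b i, site b i = p)
    {t : ℝ} (ht : 0 < t) :
    ∫ ω, Real.exp (t * f (fun j => Y (shift j (X ω)))) ∂P ≤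
      Real.exp (t * ∫ ω, f (fun j => Y (shift j (X ω))) ∂P +
        t ^ 2 * ((∑ j ∈ Λ, δ j ^ 2) / 2 +
          2 / 3 * ∑ b, ∫ ω, reach Λ δ R (u b) (X ω) ^ 2 ∂P)) := by
  obtain ⟨C, hfC⟩ := hfC
  have hΩ : Nonempty Ω := nonempty_of_isProbabilityMeasure P
  let a₀ : A := X hΩ.some 0
  -- a configuration on the blocks, extended by a constant, represents `X` as far as `f` can see
  let ext : (Fin N → Fin n → A) → Lattice d → A := fun w =>
    Function.extend (Function.uncurry site) (Function.uncurry w) fun _ => a₀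
  have hext : ∀ w b i, ext w (site b i) = w b i := fun w b i =>
    hsite.extend_apply (Function.uncurry w) (fun _ => a₀) (b, i)
  have hext' : ∀ w w' p, ext w p ≠ ext w' p → ∃ b i, site b i = p := by
    intro w w' p h
    by_contra! hc
    have hno : ¬ ∃ q, Function.uncurry site q = p := fun ⟨q, hq⟩ => hc q.1 q.2 hq
    exact h (by
      simp only [ext]
      rw [Function.extend_apply' _ _ _ hno, Function.extend_apply' _ _ _ hno])
  have hextm : Measurable ext := by
    refine measurable_pi_lambda _ fun p => ?_
    by_cases hp : ∃ q, Function.uncurry site q = p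
    · obtain ⟨⟨b, i⟩, rfl⟩ := hp
      have : (fun w => ext w (Function.uncurry site (b, i))) = fun w => w b i :=
        funext fun w => hext w b i
      rw [this]
      fun_prop
    · have : (fun w => ext w p) = fun _ => a₀ := funext fun w =>
        Function.extend_apply' _ _ _ hp
      rw [this]
      exact measurable_const
  let F : (Lattice d → A) → ℝ := fun x => f fun j => Y (shift j x)
  have hF : Measurable F :=
    hfm.comp (measurable_pi_lambda _ fun j => hY.comp (measurable_shift j))
  let restr : Ω → Fin N → Fin n → A := fun ω b i => X ω (site b i)
  have hrestr : Measurable restr :=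
    measurable_pi_lambda _ fun b => measurable_pi_lambda _ fun i => hX.measurable _
  have hagree : ∀ ω, ∀ j ∈ Λ, R (shift j (ext (restr ω))) = R (shift j (X ω)) ∧
      Y (shift j (ext (restr ω))) = Y (shift j (X ω)) := by
    intro ω j hj
    refine hdet _ _ fun i hi => ?_
    obtain ⟨b, k, hbk⟩ := hcover j hj (i + j) fun m => by
      have := (hi m).trans (Int.ofNat_le.2 (hRr _))
      simpa using this
    simp only [shift]
    rw [← hbk, hext]
  have hFext : ∀ ω, F (ext (restr ω)) = F (X ω) := by
    intro ω
    have hz : ∀ y y' : Lattice d → B, (∀ j ∈ Λ, y j = y' j) → f y' ≤ f y := by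
      intro y y' h
      refine (hf y y').trans (le_of_eq ?_)
      rw [Finset.sum_eq_zero fun j hj => by simp [h j hj], add_zero]
    exact le_antisymm (hz _ _ fun j hj => (hagree ω j hj).2.symm)
      (hz _ _ fun j hj => (hagree ω j hj).2)
  have hreach : ∀ b ω, reach Λ δ R (u b) (ext (restr ω)) = reach Λ δ R (u b) (X ω) := by
    intro b ω
    refine Finset.sum_congr rfl fun j hj => ?_
    rw [(hagree ω j hj).1]
  have hint : ∀ {H : (Fin N → Fin n → A) → ℝ}, Measurable H →
      ∫ w, H w ∂(Measure.pi fun _ => Measure.pi fun _ => ϱ) = ∫ ω, H (restr ω) ∂P := by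
    intro H hH
    rw [← map_blocks_eq_pi hX hsite]
    exact integral_map hrestr.aemeasurable hH.aestronglyMeasurable
  have hreachm : ∀ b, Measurable fun w => reach Λ δ R (u b) (ext w) := fun b =>
    (measurable_reach Λ δ hR (u b)).comp hextm
  have hFm : Measurable fun w => F (ext w) := hF.comp hextm
  have key := integral_exp_le_of_blocks ϱ (G := fun w => F (ext w)) (g := fun w => F (ext w))
    (K := fun b w => reach Λ δ R (u b) (ext w)) (δ := fun b i => δ (site b i)) hFm hFm hreachm
    ⟨C, fun _ => hfC _⟩ ⟨C, fun _ => hfC _⟩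
    ⟨∑ j ∈ Λ, δ j, fun b w => by
      rw [abs_of_nonneg (reach_nonneg hδ0 R _ _)]
      exact reach_le hδ0 R _ _⟩
    (fun b w => reach_nonneg hδ0 R _ _) (fun b i => hδ0 _) (by
      intro w w'
      have := increment_le_sum_blocks hdet hδ0 hf (u := u) hu (hext' w w')
      simp only [hext] at this
      exact this) ht
  rw [hint (H := fun w => Real.exp (t * F (ext w))) (by fun_prop), hint hFm] at key
  simp_rw [fun b => hint (H := fun w => reach Λ δ R (u b) (ext w) ^ 2) ((hreachm b).pow_const 2),
    hFext, hreach] at key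
  refine key.trans (Real.exp_le_exp.2 ?_)
  have hsq : ∑ b, ∑ i, δ (site b i) ^ 2 ≤ ∑ j ∈ Λ, δ j ^ 2 := by
    rw [← Fintype.sum_prod_type' (f := fun b i => δ (site b i) ^ 2)]
    have h1 : ∑ q : Fin N × Fin n, δ (site q.1 q.2) ^ 2 =
        ∑ p ∈ Finset.univ.image (Function.uncurry site), δ p ^ 2 := by
      rw [Finset.sum_image fun q _ q' _ h => hsite h]
      rfl
    rw [h1, ← Finset.sum_subset (Finset.inter_subset_left (s₂ := Λ)) fun p hp hp' => by
      simp [hδΛ p fun h => hp' (Finset.mem_inter.2 ⟨hp, h⟩)]]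
    exact Finset.sum_le_sum_of_subset_of_nonneg Finset.inter_subset_right fun p _ _ => sq_nonneg _
  gcongr

open Classical in
/-- The exponential inequality along the grid of cubes of side `4` with offset `s`. -/
theorem integral_exp_le_of_grid {P : Measure Ω} [IsProbabilityMeasure P] {ϱ : Measure A}
    [IsProbabilityMeasure ϱ] {X : Ω → Lattice d → A} (hX : IsIIDField P ϱ X)
    {R : (Lattice d → A) → ℕ} {Y : (Lattice d → A) → B} (hR : Measurable R) (hY : Measurable Y)
    {r : ℕ} (hRr : ∀ x, R x ≤ r)
    (hdet : ∀ x x' : Lattice d → A, (∀ i, (∀ m, |i m| ≤ (R x : ℤ)) → x' i = x i) →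
      R x' = R x ∧ Y x' = Y x)
    {Λ : Finset (Lattice d)} {f : (Lattice d → B) → ℝ} (hfm : Measurable f)
    (hfC : ∃ C, ∀ y, |f y| ≤ C) {δ : Lattice d → ℝ} (hδ0 : ∀ j, 0 ≤ δ j)
    (hδΛ : ∀ j ∉ Λ, δ j = 0)
    (hf : ∀ y y', f y' ≤ f y + ∑ j ∈ Λ, if y j ≠ y' j then δ j else 0) (s : Lattice d)
    {t : ℝ} (ht : 0 < t) :
    ∃ Z : Finset (Lattice d), ∫ ω, Real.exp (t * f (fun j => Y (shift j (X ω)))) ∂P ≤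
      Real.exp (t * ∫ ω, f (fun j => Y (shift j (X ω))) ∂P +
        t ^ 2 * ((∑ j ∈ Λ, δ j ^ 2) / 2 +
          2 / 3 * ∑ z ∈ Z, ∫ ω, reach Λ δ R (fun m => 4 * z m + s m) (X ω) ^ 2 ∂P)) := by
  -- all sites on which the function may depend, and the cubes of the grid that meet them
  let U : Finset (Lattice d) := Λ.biUnion fun j =>
    Finset.Icc (fun m => j m - (r : ℤ)) (fun m => j m + (r : ℤ))
  let Z : Finset (Lattice d) := U.image fun p m => (p m - s m) / 4
  refine ⟨Z, ?_⟩
  let eZ : Fin Z.card ≃ Z := Z.equivFin.symm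
  let eI : Fin (Fintype.card (Fin d → Fin 4)) ≃ (Fin d → Fin 4) := (Fintype.equivFin _).symm
  let u : Fin Z.card → Lattice d := fun b m => 4 * (eZ b).1 m + s m
  let site : Fin Z.card → Fin (Fintype.card (Fin d → Fin 4)) → Lattice d := fun b i m =>
    u b m + ((eI i m : ℕ) : ℤ)
  have hsite : Function.Injective (Function.uncurry site) := by
    rintro ⟨b, i⟩ ⟨b', i'⟩ h
    have h' : ∀ m, 4 * (eZ b).1 m + s m + ((eI i m : ℕ) : ℤ) =
        4 * (eZ b').1 m + s m + ((eI i' m : ℕ) : ℤ) := fun m => congrFun h m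
    have hz : ∀ m, (eZ b).1 m = (eZ b').1 m ∧ eI i m = eI i' m := fun m => by
      have h1 := h' m
      have h2 := (eI i m).2
      have h3 := (eI i' m).2
      rw [Fin.ext_iff]
      omega
    have hb : b = b' := eZ.injective (Subtype.ext (funext fun m => (hz m).1))
    have hi : i = i' := eI.injective (funext fun m => (hz m).2)
    rw [hb, hi]
  have hu : ∀ b i m, u b m ≤ site b i m ∧ site b i m ≤ u b m + 3 := by
    intro b i m
    have := (eI i m).2
    simp only [site]
    omega
  have hcover : ∀ j ∈ Λ, ∀ p : Lattice d, (∀ m, |p m - j m| ≤ (r : ℤ)) → ∃ b i, site b i = p := by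
    intro j hj p hp
    have hpU : p ∈ U := by
      refine Finset.mem_biUnion.2 ⟨j, hj, Finset.mem_Icc.2 ⟨fun m => ?_, fun m => ?_⟩⟩
      all_goals
        have := abs_le.1 (hp m)
        simp only
        omega
    have hpZ : (fun m => (p m - s m) / 4) ∈ Z := Finset.mem_image_of_mem _ hpU
    refine ⟨eZ.symm ⟨_, hpZ⟩, eI.symm fun m => ⟨((p m - s m) % 4).toNat, by omega⟩, ?_⟩
    funext m
    simp only [site, u, Equiv.apply_symm_apply]
    omega
  refine (integral_exp_le_of_cover hX hR hY hRr hdet hfm hfC hδ0 hδΛ hf hsite hu hcover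
    ht).trans (le_of_eq ?_)
  have hsum : ∑ b, ∫ ω, reach Λ δ R (u b) (X ω) ^ 2 ∂P =
      ∑ z ∈ Z, ∫ ω, reach Λ δ R (fun m => 4 * z m + s m) (X ω) ^ 2 ∂P := by
    rw [← Finset.sum_coe_sort Z fun z => ∫ ω, reach Λ δ R (fun m => 4 * z m + s m) (X ω) ^ 2 ∂P]
    exact Fintype.sum_equiv eZ _ _ fun b => rfl
  rw [hsum]

end Field

/-! ### Averaging over the grids -/

section Average

variable {d : ℕ} {Ω A B : Type*} [MeasurableSpace Ω] [MeasurableSpace A] [MeasurableSpace B]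

open Classical in
/-- The average of the exponential inequalities over all offsets of the grid of cubes. Every cube of
side `4` belongs to exactly one of the `4 ^ d` grids. -/
theorem integral_exp_le_of_tsum_le {P : Measure Ω} [IsProbabilityMeasure P] {ϱ : Measure A}
    [IsProbabilityMeasure ϱ] {X : Ω → Lattice d → A} (hX : IsIIDField P ϱ X)
    {R : (Lattice d → A) → ℕ} {Y : (Lattice d → A) → B} (hR : Measurable R) (hY : Measurable Y)
    {r : ℕ} (hRr : ∀ x, R x ≤ r)
    (hdet : ∀ x x' : Lattice d → A, (∀ i, (∀ m, |i m| ≤ (R x : ℤ)) → x' i = x i) →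
      R x' = R x ∧ Y x' = Y x)
    {Λ : Finset (Lattice d)} {f : (Lattice d → B) → ℝ} (hfm : Measurable f)
    (hfC : ∃ C, ∀ y, |f y| ≤ C) {δ : Lattice d → ℝ} (hδ0 : ∀ j, 0 ≤ δ j)
    (hδΛ : ∀ j ∉ Λ, δ j = 0)
    (hf : ∀ y y', f y' ≤ f y + ∑ j ∈ Λ, if y j ≠ y' j then δ j else 0)
    {T : ℝ} (hT0 : 0 ≤ T)
    (hT : ∑' u, ENNReal.ofReal (∫ ω, reach Λ δ R u (X ω) ^ 2 ∂P) ≤ ENNReal.ofReal T)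
    {t : ℝ} (ht : 0 < t) :
    ∫ ω, Real.exp (t * f (fun j => Y (shift j (X ω)))) ∂P ≤
      Real.exp (t * ∫ ω, f (fun j => Y (shift j (X ω))) ∂P +
        t ^ 2 * ((∑ j ∈ Λ, δ j ^ 2) / 2 + 2 / 3 * (T / 4 ^ d))) := by
  let I : Lattice d → ℝ := fun u => ∫ ω, reach Λ δ R u (X ω) ^ 2 ∂P
  have hI : ∀ u, 0 ≤ I u := fun u => integral_nonneg fun ω => sq_nonneg _
  let c : (Fin d → Fin 4) → Lattice d → Lattice d := fun s z m => 4 * z m + ((s m : ℕ) : ℤ)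
  choose Z hZ using fun s : Fin d → Fin 4 =>
    integral_exp_le_of_grid hX hR hY hRr hdet hfm hfC hδ0 hδΛ hf (fun m => ((s m : ℕ) : ℤ)) ht
  have hsum : ∑ s, ∑ z ∈ Z s, I (c s z) ≤ T := by
    have hinj : Function.Injective fun q : (Fin d → Fin 4) × Lattice d => c q.1 q.2 := by
      rintro ⟨s, z⟩ ⟨s', z'⟩ h
      have h' : ∀ m, s m = s' m ∧ z m = z' m := fun m => by
        have h1 : 4 * z m + ((s m : ℕ) : ℤ) = 4 * z' m + ((s' m : ℕ) : ℤ) := congrFun h m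
        have h2 := (s m).2
        have h3 := (s' m).2
        rw [Fin.ext_iff]
        omega
      exact Prod.ext (funext fun m => (h' m).1) (funext fun m => (h' m).2)
    rw [← ENNReal.ofReal_le_ofReal_iff hT0]
    refine le_trans ?_ hT
    rw [ENNReal.ofReal_sum_of_nonneg fun s _ => Finset.sum_nonneg fun z _ => hI _]
    calc ∑ s, ENNReal.ofReal (∑ z ∈ Z s, I (c s z))
        = ∑ s, ∑ z ∈ Z s, ENNReal.ofReal (I (c s z)) :=
          Finset.sum_congr rfl fun s _ => ENNReal.ofReal_sum_of_nonneg fun z _ => hI _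
      _ ≤ ∑ s, ∑' z, ENNReal.ofReal (I (c s z)) :=
          Finset.sum_le_sum fun s _ => ENNReal.sum_le_tsum _
      _ = ∑' q : (Fin d → Fin 4) × Lattice d, ENNReal.ofReal (I (c q.1 q.2)) := by
          rw [ENNReal.tsum_prod (f := fun s z => ENNReal.ofReal (I (c s z))), tsum_fintype]
      _ ≤ ∑' u, ENNReal.ofReal (I u) :=
          ENNReal.tsum_comp_le_tsum_of_injective hinj fun u => ENNReal.ofReal (I u)
  set J := ∫ ω, Real.exp (t * f (fun j => Y (shift j (X ω)))) ∂P with hJ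
  set E := ∫ ω, f (fun j => Y (shift j (X ω))) ∂P with hE
  set D := ∑ j ∈ Λ, δ j ^ 2 with hD
  have hJpos : 0 < J := by
    obtain ⟨C, hfC⟩ := hfC
    have hXm : Measurable X := measurable_pi_lambda _ hX.measurable
    have hFm : Measurable fun ω => f (fun j => Y (shift j (X ω))) :=
      hfm.comp (measurable_pi_lambda _ fun j => hY.comp ((measurable_shift j).comp hXm))
    exact integral_exp_pos (integrable_exp_of_abs_le hFm (fun ω => hfC _) t)
  rw [← Real.log_le_iff_le_exp hJpos]
  have hlog : ∀ s, Real.log J - t * E - t ^ 2 * (D / 2) ≤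
      t ^ 2 * (2 / 3) * ∑ z ∈ Z s, I (c s z) := fun s => by
    have := (Real.log_le_iff_le_exp hJpos).2 (hZ s)
    simp only [I, c]
    linarith
  have havg := Finset.sum_le_sum fun s (_ : s ∈ Finset.univ) => hlog s
  rw [Finset.sum_const, ← Finset.mul_sum, Finset.card_univ, Fintype.card_fun, Fintype.card_fin,
    Fintype.card_fin, nsmul_eq_mul] at havg
  push_cast at havg
  have h4 : (0 : ℝ) < 4 ^ d := by positivity
  have h5 : Real.log J - t * E - t ^ 2 * (D / 2) ≤ t ^ 2 * (2 / 3) * T / 4 ^ d := by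
    rw [le_div_iff₀ h4, mul_comm]
    exact havg.trans (mul_le_mul_of_nonneg_left hsum (by positivity))
  have h6 : t ^ 2 * (2 / 3) * T / 4 ^ d = t ^ 2 * (2 / 3 * (T / 4 ^ d)) := by ring
  linarith

/-- Cauchy–Schwarz for the correlations of a square-summable family. -/
theorem tsum_ofReal_mul_le (δ : Lattice d → ℝ) (hδ0 : ∀ j, 0 ≤ δ j) (v v' : Lattice d) :
    ∑' u, ENNReal.ofReal (δ (u + v)) * ENNReal.ofReal (δ (u + v')) ≤
      ∑' j, ENNReal.ofReal (δ j ^ 2) := by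
  have h1 : ∀ w : Lattice d, ∑' u, ENNReal.ofReal (δ (u + w) ^ 2 / 2) =
      ∑' u, ENNReal.ofReal (δ u ^ 2 / 2) := fun w =>
    (Equiv.addRight w).tsum_eq fun u => ENNReal.ofReal (δ u ^ 2 / 2)
  calc ∑' u, ENNReal.ofReal (δ (u + v)) * ENNReal.ofReal (δ (u + v'))
      ≤ ∑' u, (ENNReal.ofReal (δ (u + v) ^ 2 / 2) + ENNReal.ofReal (δ (u + v') ^ 2 / 2)) := by
        refine ENNReal.tsum_le_tsum fun u => ?_
        rw [← ENNReal.ofReal_mul (hδ0 _), ← ENNReal.ofReal_add (by positivity) (by positivity)]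
        apply ENNReal.ofReal_le_ofReal
        nlinarith [sq_nonneg (δ (u + v) - δ (u + v'))]
    _ = ∑' u, (ENNReal.ofReal (δ u ^ 2 / 2) + ENNReal.ofReal (δ u ^ 2 / 2)) := by
        rw [ENNReal.tsum_add, ENNReal.tsum_add, h1, h1]
    _ = ∑' j, ENNReal.ofReal (δ j ^ 2) := by
        refine tsum_congr fun u => ?_
        rw [← ENNReal.ofReal_add (by positivity) (by positivity), add_halves]

open Classical in
/-- The second moments of the total oscillation reaching a cube, summed over all cubes of side `4`,
in terms of a translation invariant bound on the joint tails of the radii. -/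
theorem tsum_reach_sq_le {P : Measure Ω} [IsProbabilityMeasure P] {X : Ω → Lattice d → A}
    (hX : Measurable X) {R : (Lattice d → A) → ℕ} (hR : Measurable R) {Λ : Finset (Lattice d)}
    {δ : Lattice d → ℝ} (hδ0 : ∀ j, 0 ≤ δ j) (hδΛ : ∀ j ∉ Λ, δ j = 0)
    {W : Lattice d → Lattice d → ℝ≥0∞}
    (hW : ∀ j k u, P {ω | cubeDist (j - u) ≤ R (shift j (X ω)) ∧
      cubeDist (k - u) ≤ R (shift k (X ω))} ≤ W (j - u) (k - u)) :
    ∑' u, ENNReal.ofReal (∫ ω, reach Λ δ R u (X ω) ^ 2 ∂P) ≤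
      ENNReal.ofReal (∑ j ∈ Λ, δ j ^ 2) * ∑' v, ∑' v', W v v' := by
  let a : Lattice d → ℝ≥0∞ := fun j => ENNReal.ofReal (δ j)
  let S : Lattice d → Lattice d → Set Ω := fun u j => {ω | cubeDist (j - u) ≤ R (shift j (X ω))}
  have hS : ∀ u j, MeasurableSet (S u j) := fun u j =>
    measurableSet_le measurable_const (hR.comp ((measurable_shift j).comp hX))
  have hone : ∀ u, ENNReal.ofReal (∫ ω, reach Λ δ R u (X ω) ^ 2 ∂P) ≤
      ∑' v, ∑' v', a (u + v) * a (u + v') * W v v' := by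
    intro u
    have hpt : ∀ ω, ENNReal.ofReal (reach Λ δ R u (X ω) ^ 2) =
        ∑ j ∈ Λ, ∑ k ∈ Λ, a j * a k * (S u j ∩ S u k).indicator 1 ω := by
      intro ω
      rw [sq, ENNReal.ofReal_mul (reach_nonneg hδ0 R u _)]
      have hlin : ENNReal.ofReal (reach Λ δ R u (X ω)) =
          ∑ j ∈ Λ, a j * (S u j).indicator 1 ω := by
        rw [reach, ENNReal.ofReal_sum_of_nonneg fun j _ => by split_ifs <;> simp [hδ0 j]]
        refine Finset.sum_congr rfl fun j _ => ?_
        simp only [Set.indicator_apply, S, Set.mem_ofPred_eq]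
        split_ifs <;> simp [a]
      rw [hlin, Finset.sum_mul_sum]
      refine Finset.sum_congr rfl fun j _ => Finset.sum_congr rfl fun k _ => ?_
      rw [Set.inter_indicator_one]
      simp only [Pi.mul_apply]
      ring
    have hm : ∀ j k, Measurable fun ω => a j * a k * (S u j ∩ S u k).indicator 1 ω := fun j k =>
      (measurable_one.indicator ((hS u j).inter (hS u k))).const_mul _
    have hint : ENNReal.ofReal (∫ ω, reach Λ δ R u (X ω) ^ 2 ∂P) =
        ∑ j ∈ Λ, ∑ k ∈ Λ, a j * a k * P (S u j ∩ S u k) := by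
      rw [ofReal_integral_eq_lintegral_ofReal]
      · simp_rw [hpt]
        rw [lintegral_finsetSum _ fun j _ => Finset.measurable_sum _ fun k _ => hm j k]
        refine Finset.sum_congr rfl fun j _ => ?_
        rw [lintegral_finsetSum _ fun k _ => hm j k]
        refine Finset.sum_congr rfl fun k _ => ?_
        rw [lintegral_const_mul _ (measurable_one.indicator ((hS u j).inter (hS u k))),
          lintegral_indicator_one ((hS u j).inter (hS u k))]
      · refine integrable_of_abs_le (((measurable_reach Λ δ hR u).comp hX).pow_const 2)
          (C := (∑ j ∈ Λ, δ j) ^ 2) fun ω => ?_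
        rw [abs_of_nonneg (sq_nonneg _)]
        exact pow_le_pow_left₀ (reach_nonneg hδ0 R u _) (reach_le hδ0 R u _) 2
      · exact Filter.Eventually.of_forall fun ω => sq_nonneg _
    rw [hint]
    calc ∑ j ∈ Λ, ∑ k ∈ Λ, a j * a k * P (S u j ∩ S u k)
        ≤ ∑ j ∈ Λ, ∑ k ∈ Λ, a j * a k * W (j - u) (k - u) := by
          refine Finset.sum_le_sum fun j _ => Finset.sum_le_sum fun k _ => ?_
          gcongr
          exact hW j k u
      _ ≤ ∑ j ∈ Λ, ∑' k, a j * a k * W (j - u) (k - u) :=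
          Finset.sum_le_sum fun j _ => ENNReal.sum_le_tsum _
      _ ≤ ∑' j, ∑' k, a j * a k * W (j - u) (k - u) := ENNReal.sum_le_tsum _
      _ = ∑' v, ∑' v', a (u + v) * a (u + v') * W v v' := by
          rw [← (Equiv.addLeft u).tsum_eq fun j => ∑' k, a j * a k * W (j - u) (k - u)]
          refine tsum_congr fun v => ?_
          rw [← (Equiv.addLeft u).tsum_eq]
          simp
  calc ∑' u, ENNReal.ofReal (∫ ω, reach Λ δ R u (X ω) ^ 2 ∂P)
      ≤ ∑' u, ∑' v, ∑' v', a (u + v) * a (u + v') * W v v' := ENNReal.tsum_le_tsum hone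
    _ = ∑' v, ∑' v', (∑' u, a (u + v) * a (u + v')) * W v v' := by
        rw [ENNReal.tsum_comm]
        refine tsum_congr fun v => ?_
        rw [ENNReal.tsum_comm]
        exact tsum_congr fun v' => ENNReal.tsum_mul_right
    _ ≤ ∑' v, ∑' v', ENNReal.ofReal (∑ j ∈ Λ, δ j ^ 2) * W v v' := by
        refine ENNReal.tsum_le_tsum fun v => ENNReal.tsum_le_tsum fun v' => ?_
        gcongr
        refine (tsum_ofReal_mul_le δ hδ0 v v').trans (le_of_eq ?_)
        rw [ENNReal.ofReal_sum_of_nonneg fun j _ => sq_nonneg _]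
        exact tsum_eq_sum fun j hj => by simp [hδΛ j hj]
    _ = _ := by
        simp_rw [ENNReal.tsum_mul_left]

end Average

/-! ### Summing the bounds on joint tails -/

section Counting

variable {d : ℕ} {Ω : Type*} [MeasurableSpace Ω]

/-- The `ℓ^∞` norm on the lattice, as a natural number. -/
def supNorm (v : Lattice d) : ℕ := Finset.univ.sup fun m => (v m).natAbs

theorem supNorm_le_iff {v : Lattice d} {n : ℕ} : supNorm v ≤ n ↔ ∀ m, |v m| ≤ (n : ℤ) := by
  simp only [supNorm, Finset.sup_le_iff, Finset.mem_univ, true_imp_iff]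
  refine forall_congr' fun m => ?_
  rw [Int.abs_eq_natAbs]
  exact_mod_cast Iff.rfl

theorem norm_eq_supNorm (v : Lattice d) : ‖v‖ = supNorm v := by
  have h : ∀ n : ℕ, ‖v‖ ≤ n ↔ supNorm v ≤ n := fun n => by
    rw [pi_norm_le_iff_of_nonneg (Nat.cast_nonneg n), supNorm_le_iff]
    refine forall_congr' fun m => ?_
    rw [Int.norm_eq_abs]
    exact_mod_cast Iff.rfl
  refine le_antisymm ((h _).2 le_rfl) ?_
  have h1 : supNorm v ≤ ⌊‖v‖⌋₊ := by
    rw [supNorm_le_iff]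
    intro m
    have h2 : (v m).natAbs ≤ ⌊‖v‖⌋₊ := by
      refine Nat.le_floor ?_
      rw [Nat.cast_natAbs, Int.cast_abs, ← Int.norm_eq_abs]
      exact norm_le_pi_norm v m
    rw [Int.abs_eq_natAbs]
    exact_mod_cast h2
  exact (Nat.cast_le.2 h1).trans (Nat.floor_le (norm_nonneg _))

/-- The number of lattice points with a property that confines them to a box. -/
theorem tsum_ite_le (Q : Lattice d → Prop) [DecidablePred Q] {a b : ℤ}
    (h : ∀ v, Q v → ∀ m, a ≤ v m ∧ v m ≤ b) :
    ∑' v, (if Q v then 1 else 0 : ℝ≥0∞) ≤ ((b + 1 - a).toNat : ℝ≥0∞) ^ d := by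
  have hmem : ∀ v, Q v → v ∈ Finset.Icc (fun _ : Fin d => a) (fun _ => b) := fun v hv =>
    Finset.mem_Icc.2 ⟨fun m => (h v hv m).1, fun m => (h v hv m).2⟩
  rw [tsum_eq_sum (s := Finset.Icc (fun _ : Fin d => a) (fun _ => b)) fun v hv => by
    rw [if_neg fun hq => hv (hmem v hq)]]
  calc ∑ v ∈ Finset.Icc (fun _ : Fin d => a) (fun _ => b), (if Q v then 1 else 0 : ℝ≥0∞)
      ≤ ∑ v ∈ Finset.Icc (fun _ : Fin d => a) (fun _ => b), 1 :=
        Finset.sum_le_sum fun v _ => by split_ifs <;> simp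
    _ = _ := by simp [Pi.card_Icc]

/-- If at radius `n` a property confines lattice points to a box of side at most `κ (2 n + 1)`,
the probabilities of this property sum to at most `κ ^ d` times the mean volume. -/
theorem tsum_measure_le {P : Measure Ω} {N : Ω → ℕ} (hN : Measurable N) {κ : NNReal}
    (Q : Lattice d → ℕ → Prop)
    (h : ∀ n : ℕ, ∃ a b : ℤ, (∀ v, Q v n → ∀ m, a ≤ v m ∧ v m ≤ b) ∧
      ((b + 1 - a).toNat : ℝ) ≤ κ * (2 * n + 1)) :
    ∑' v, P {ω | Q v (N ω)} ≤ (κ : ℝ≥0∞) ^ d * ∫⁻ ω, (2 * (N ω : ℝ≥0∞) + 1) ^ d ∂P := by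
  classical
  have hS : ∀ v, MeasurableSet {ω | Q v (N ω)} := fun v =>
    hN (MeasurableSet.of_discrete (s := {n | Q v n}))
  have hind : ∀ v, P {ω | Q v (N ω)} = ∫⁻ ω, (if Q v (N ω) then 1 else 0 : ℝ≥0∞) ∂P := fun v => by
    rw [← lintegral_indicator_one (hS v)]
    rfl
  have hmeas : Measurable fun ω => (2 * (N ω : ℝ≥0∞) + 1) ^ d :=
    (measurable_of_countable fun n : ℕ => (2 * (n : ℝ≥0∞) + 1) ^ d).comp hN
  simp_rw [hind]
  rw [← lintegral_tsum fun v => (Measurable.ite (hS v) measurable_const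
    measurable_const).aemeasurable, ← lintegral_const_mul _ hmeas]
  refine lintegral_mono fun ω => ?_
  obtain ⟨a, b, hab, hκ⟩ := h (N ω)
  refine (tsum_ite_le (fun v => Q v (N ω)) hab).trans ?_
  simp only [← mul_pow]
  gcongr
  have : ((b + 1 - a).toNat : NNReal) ≤ κ * (2 * (N ω : NNReal) + 1) := by exact_mod_cast hκ
  exact_mod_cast this

variable {P : Measure Ω} {N : Ω → ℕ}

theorem tsum_measure_cubeDist_le (hN : Measurable N) :
    ∑' v : Lattice d, P {ω | cubeDist v ≤ N ω} ≤
      2 ^ d * ∫⁻ ω, (2 * (N ω : ℝ≥0∞) + 1) ^ d ∂P := by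
  refine tsum_measure_le hN (κ := 2) (fun v n => cubeDist v ≤ n) fun n => ?_
  rcases Nat.eq_zero_or_pos n with rfl | hn
  · exact ⟨1, 0, fun v hv => absurd hv (by have := one_le_cubeDist v; omega), by norm_num⟩
  · refine ⟨-n, n + 3, fun v hv => (cubeDist_le_iff hn).1 hv, ?_⟩
    have h1 : ((n : ℤ) + 3 + 1 - -n).toNat = 2 * n + 4 := by omega
    have h2 : (1 : ℝ) ≤ n := by exact_mod_cast hn
    rw [h1]
    push_cast
    linarith

/-- At distance at least `3` only radii at least `3` contribute, for which the ratio of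
`2 n + 4` to `2 n + 1` is at most `10 / 7`. -/
theorem tsum_measure_three_le_cubeDist_le (hN : Measurable N) :
    ∑' v : Lattice d, P {ω | 3 ≤ cubeDist v ∧ cubeDist v ≤ N ω} ≤
      ((10 / 7 : NNReal) : ℝ≥0∞) ^ d * ∫⁻ ω, (2 * (N ω : ℝ≥0∞) + 1) ^ d ∂P := by
  refine tsum_measure_le hN (fun v n => 3 ≤ cubeDist v ∧ cubeDist v ≤ n) fun n => ?_
  rcases Nat.lt_or_ge n 3 with hn | hn
  · exact ⟨1, 0, fun v hv => absurd hv (by omega), by norm_num; positivity⟩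
  · refine ⟨-n, n + 3, fun v hv => (cubeDist_le_iff (by omega)).1 hv.2, ?_⟩
    have h1 : ((n : ℤ) + 3 + 1 - -n).toNat = 2 * n + 4 := by omega
    have h2 : (3 : ℝ) ≤ n := by exact_mod_cast hn
    rw [h1]
    push_cast
    linarith

theorem tsum_measure_half_supNorm_le (hN : Measurable N) :
    ∑' v : Lattice d, P {ω | (supNorm v + 1) / 2 ≤ N ω} ≤
      2 ^ d * ∫⁻ ω, (2 * (N ω : ℝ≥0∞) + 1) ^ d ∂P := by
  refine tsum_measure_le hN (κ := 2) (fun v n => (supNorm v + 1) / 2 ≤ n) fun n => ?_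
  refine ⟨-(2 * n), 2 * n, fun v hv m => ?_, ?_⟩
  · have h1 : supNorm v ≤ 2 * n := by omega
    exact abs_le.1 (by exact_mod_cast supNorm_le_iff.1 h1 m)
  · have h1 : (2 * (n : ℤ) + 1 - -(2 * n)).toNat = 4 * n + 1 := by omega
    rw [h1]
    push_cast
    linarith

theorem tsum_measure_mul_supNorm_le (hN : Measurable N) {α : ℝ} (hα0 : 0 < α) (hα1 : α ≤ 1) :
    ∑' v : Lattice d, P {ω | α * supNorm v ≤ N ω} ≤
      ENNReal.ofReal α⁻¹ ^ d * ∫⁻ ω, (2 * (N ω : ℝ≥0∞) + 1) ^ d ∂P := by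
  refine tsum_measure_le hN (κ := α⁻¹.toNNReal) (fun v n => α * supNorm v ≤ n) fun n => ?_
  refine ⟨-⌊n / α⌋₊, ⌊n / α⌋₊, fun v hv m => ?_, ?_⟩
  · have h1 : supNorm v ≤ ⌊n / α⌋₊ := Nat.le_floor (by rw [le_div_iff₀ hα0]; linarith)
    exact abs_le.1 (supNorm_le_iff.1 h1 m)
  · have h1 : ((⌊n / α⌋₊ : ℤ) + 1 - -⌊n / α⌋₊).toNat = 2 * ⌊n / α⌋₊ + 1 := by omega
    have h2 : (⌊n / α⌋₊ : ℝ) ≤ n * α⁻¹ := by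
      rw [← div_eq_mul_inv]
      exact Nat.floor_le (by positivity)
    have h3 : (1 : ℝ) ≤ α⁻¹ := (one_le_inv₀ hα0).2 hα1
    rw [h1, Real.coe_toNNReal _ (by positivity)]
    push_cast
    nlinarith

/-- Markov's inequality for the mean volume. -/
theorem pow_mul_measure_le (hN : Measurable N) {c h : ℕ} (hc : c ≤ 2 * h) :
    ((c : ℝ≥0∞) + 1) ^ d * P {ω | h ≤ N ω} ≤ ∫⁻ ω, (2 * (N ω : ℝ≥0∞) + 1) ^ d ∂P := by
  have hS : MeasurableSet {ω | h ≤ N ω} := measurableSet_le measurable_const hN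
  rw [← lintegral_indicator_const hS]
  refine lintegral_mono fun ω => ?_
  simp only [Set.indicator_apply, Set.mem_ofPred_eq]
  split_ifs with hω
  · gcongr
    exact_mod_cast hc.trans (by omega)
  · exact zero_le

/-- The bound on the joint tail `P (R_j ≥ a, R_k ≥ b)` of the radii at two sites `j` and `k`, seen
from a cube relative to which they have the positions `v` and `v'`; here `a` and `b` are the
distances to the cube and `c` is the distance of the two sites. Short-range factorization is used
only if `a` or `b` is at least `c`. Otherwise one or both events are relaxed to radii at most
`⌈c / 2⌉`, so that they depend on disjoint balls and are independent. -/
noncomputable def pairBound (p q : ℕ → ℝ≥0∞) (v v' : Lattice d) : ℝ≥0∞ :=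
  let a := cubeDist v
  let b := cubeDist v'
  let c := supNorm (v - v')
  let h := (c + 1) / 2
  if c ≤ b then p a * q c
  else if c ≤ a then p b * q c
  else if a + b ≤ c + 1 then p a * p b
  else if a ≤ h then p a * p h
  else if b ≤ h then p b * p h
  else p h * p h

theorem tsum_sub_left (g : Lattice d → ℝ≥0∞) (v : Lattice d) : ∑' v', g (v - v') = ∑' m, g m :=
  (Equiv.subLeft v).tsum_eq g

theorem tsum_sub_right (g : Lattice d → ℝ≥0∞) (v : Lattice d) : ∑' v', g (v' - v) = ∑' m, g m :=
  (Equiv.subRight v).tsum_eq g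

open Classical in
/-- `pairBound` as a sum over its cases. In the last three of them `a, b < c` and `a + b > c + 1`,
so that both sites are at distance at least `3` from the cube. -/
theorem pairBound_le (p q : ℕ → ℝ≥0∞) (v v' : Lattice d) :
    pairBound p q v v' ≤ p (cubeDist v) * q (supNorm (v - v')) +
      p (cubeDist v') * q (supNorm (v - v')) + p (cubeDist v) * p (cubeDist v') +
      ((if 3 ≤ cubeDist v then p (cubeDist v) else 0) * p ((supNorm (v - v') + 1) / 2) +
      (if 3 ≤ cubeDist v' then p (cubeDist v') else 0) * p ((supNorm (v - v') + 1) / 2) +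
      (if cubeDist v < supNorm (v - v') then 1 else 0) *
        (p ((supNorm (v - v') + 1) / 2) * p ((supNorm (v - v') + 1) / 2))) := by
  unfold pairBound
  set a := cubeDist v
  set b := cubeDist v'
  set c := supNorm (v - v')
  simp only
  by_cases h1 : c ≤ b
  · rw [if_pos h1]
    exact le_add_right (le_add_right le_self_add)
  rw [if_neg h1]
  by_cases h2 : c ≤ a
  · rw [if_pos h2]
    exact le_add_right (le_add_right le_add_self)
  rw [if_neg h2]
  by_cases h3 : a + b ≤ c + 1
  · rw [if_pos h3]
    exact le_add_right le_add_self
  rw [if_neg h3]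
  refine le_add_left ?_
  by_cases h4 : a ≤ (c + 1) / 2
  · rw [if_pos h4, if_pos (show 3 ≤ a by omega)]
    exact le_add_right le_self_add
  rw [if_neg h4]
  by_cases h5 : b ≤ (c + 1) / 2
  · rw [if_pos h5, if_pos (show 3 ≤ b by omega)]
    exact le_add_right le_add_self
  rw [if_neg h5, if_pos (show a < c by omega), one_mul]
  exact le_add_self

/-- In dimension one two sites that are farther from each other than from the cube do not lie on the
same side of it. Hence `a + b ≤ c + 1`, and the last three cases of `pairBound` do not occur. -/
theorem pairBound_le_of_dim_one (p q : ℕ → ℝ≥0∞) (v v' : Lattice 1) :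
    pairBound p q v v' ≤ p (cubeDist v) * q (supNorm (v - v')) +
      p (cubeDist v') * q (supNorm (v - v')) + p (cubeDist v) * p (cubeDist v') := by
  have key : cubeDist v < supNorm (v - v') → cubeDist v' < supNorm (v - v') →
      cubeDist v + cubeDist v' ≤ supNorm (v - v') + 1 := by
    simp only [cubeDist, supNorm, Finset.univ_unique, Finset.sup_singleton, Pi.sub_apply]
    omega
  simp only [pairBound]
  split_ifs
  · rw [add_assoc]
    exact le_self_add
  · rw [add_right_comm]
    exact le_add_self
  · exact le_add_self
  all_goals exact absurd (key (by omega) (by omega)) (by omega)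

theorem tsum_mul_sub_left (g G : Lattice d → ℝ≥0∞) :
    ∑' v, ∑' v', g v * G (v - v') = (∑' v, g v) * ∑' m, G m := by
  simp_rw [ENNReal.tsum_mul_left, tsum_sub_left, ENNReal.tsum_mul_right]

theorem tsum_mul_sub_right (g G : Lattice d → ℝ≥0∞) :
    ∑' v, ∑' v', g v' * G (v - v') = (∑' v, g v) * ∑' m, G m := by
  rw [ENNReal.tsum_comm]
  simp_rw [ENNReal.tsum_mul_left, tsum_sub_right, ENNReal.tsum_mul_right]

open Classical in
/-- The case of two remote sites. At most `(2 c + 2) ^ d` positions are closer than `c` to the cube,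
and Markov's inequality absorbs `(c + 1) ^ d` into one of the two tails at `⌈c / 2⌉`. -/
theorem tsum_far_le (hN : Measurable N) :
    ∑' v : Lattice d, ∑' v', (if cubeDist v < supNorm (v - v') then 1 else 0) *
      (P {ω | (supNorm (v - v') + 1) / 2 ≤ N ω} * P {ω | (supNorm (v - v') + 1) / 2 ≤ N ω}) ≤
      4 ^ d * (∫⁻ ω, (2 * (N ω : ℝ≥0∞) + 1) ^ d ∂P) ^ 2 := by
  set E := ∫⁻ ω, (2 * (N ω : ℝ≥0∞) + 1) ^ d ∂P with hE
  let g : Lattice d → ℝ≥0∞ := fun m => P {ω | (supNorm m + 1) / 2 ≤ N ω}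
  have hcount : ∀ m : Lattice d, ∑' v : Lattice d,
      (if cubeDist v < supNorm m then 1 else 0 : ℝ≥0∞) ≤ 2 ^ d * ((supNorm m : ℝ≥0∞) + 1) ^ d := by
    intro m
    rcases Nat.lt_or_ge (supNorm m) 2 with hc | hc
    · have : ∀ v : Lattice d, ¬ cubeDist v < supNorm m := fun v => by
        have := one_le_cubeDist v
        omega
      simp [this]
    · refine (tsum_ite_le (fun v => cubeDist v < supNorm m) (a := -((supNorm m - 1 : ℕ) : ℤ))
        (b := (supNorm m - 1 : ℕ) + 3) fun v hv => ?_).trans ?_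
      · exact (cubeDist_le_iff (by omega)).1 (by omega)
      · have h1 : (((supNorm m - 1 : ℕ) : ℤ) + 3 + 1 - -((supNorm m - 1 : ℕ) : ℤ)).toNat =
            2 * (supNorm m + 1) := by omega
        rw [h1, ← mul_pow]
        push_cast
        rfl
  calc ∑' v : Lattice d, ∑' v', (if cubeDist v < supNorm (v - v') then 1 else 0) *
        (g (v - v') * g (v - v'))
      = ∑' v : Lattice d, ∑' m, (if cubeDist v < supNorm m then 1 else 0) * (g m * g m) := by
        refine tsum_congr fun v => ?_
        exact tsum_sub_left (fun m => (if cubeDist v < supNorm m then 1 else 0) * (g m * g m)) v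
    _ = ∑' m, (∑' v : Lattice d, (if cubeDist v < supNorm m then 1 else 0)) * (g m * g m) := by
        rw [ENNReal.tsum_comm]
        simp_rw [ENNReal.tsum_mul_right]
    _ ≤ ∑' m, (2 ^ d * E) * g m := by
        refine ENNReal.tsum_le_tsum fun m => ?_
        have h1 : ((supNorm m : ℝ≥0∞) + 1) ^ d * g m ≤ E := pow_mul_measure_le hN (by omega)
        calc _ ≤ (2 ^ d * ((supNorm m : ℝ≥0∞) + 1) ^ d) * (g m * g m) := by
              gcongr
              exact hcount m
          _ = 2 ^ d * (((supNorm m : ℝ≥0∞) + 1) ^ d * g m) * g m := by ring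
          _ ≤ _ := by gcongr
    _ = (2 ^ d * E) * ∑' m, g m := ENNReal.tsum_mul_left
    _ ≤ (2 ^ d * E) * (2 ^ d * E) := by
        gcongr
        exact tsum_measure_half_supNorm_le hN
    _ = _ := by
        rw [show (4 : ℝ≥0∞) = 2 * 2 by norm_num, mul_pow]
        ring

/-- The sum of the bounds on the joint tails, over all positions relative to a cube. -/
theorem tsum_pairBound_le (hd : 1 ≤ d) (hN : Measurable N) {α : ℝ} (hα0 : 0 < α) (hα1 : α ≤ 1) :
    ∑' v : Lattice d, ∑' v', pairBound (fun a => P {ω | a ≤ N ω})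
      (fun c => P {ω | α * c ≤ N ω}) v v' ≤
      ENNReal.ofReal (15 / 4 * 4 ^ d * α⁻¹ ^ d) *
        (∫⁻ ω, (2 * (N ω : ℝ≥0∞) + 1) ^ d ∂P) ^ 2 := by
  classical
  set E := ∫⁻ ω, (2 * (N ω : ℝ≥0∞) + 1) ^ d ∂P with hE
  set p : ℕ → ℝ≥0∞ := fun a => P {ω | a ≤ N ω} with hp
  set q : ℕ → ℝ≥0∞ := fun c => P {ω | α * c ≤ N ω} with hq
  have hα : (1 : ℝ) ≤ α⁻¹ ^ d := one_le_pow₀ ((one_le_inv₀ hα0).2 hα1)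
  have he : ∑' v : Lattice d, p (cubeDist v) ≤ 2 ^ d * E := tsum_measure_cubeDist_le hN
  have hs : ∑' v : Lattice d, q (supNorm v) ≤ ENNReal.ofReal α⁻¹ ^ d * E :=
    tsum_measure_mul_supNorm_le hN hα0 hα1
  have hh : ∑' v : Lattice d, p ((supNorm v + 1) / 2) ≤ 2 ^ d * E :=
    tsum_measure_half_supNorm_le hN
  have h3 : ∑' v : Lattice d, (if 3 ≤ cubeDist v then p (cubeDist v) else 0) ≤
      ((10 / 7 : NNReal) : ℝ≥0∞) ^ d * E := by
    refine le_trans (le_of_eq (tsum_congr fun v => ?_)) (tsum_measure_three_le_cubeDist_le hN)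
    split_ifs with h <;> simp [h, hp]
  have hαd : ENNReal.ofReal α⁻¹ ^ d = ENNReal.ofReal (α⁻¹ ^ d) :=
    (ENNReal.ofReal_pow (by positivity) d).symm
  rw [hαd] at hs
  have hc2 : (2 : ℝ≥0∞) ^ d = ENNReal.ofReal (2 ^ d) := by
    rw [ENNReal.ofReal_pow (by norm_num)]
    norm_num
  have hc107 : ((10 / 7 : NNReal) : ℝ≥0∞) ^ d = ENNReal.ofReal ((10 / 7) ^ d) := by
    rw [ENNReal.ofReal_pow (by norm_num)]
    congr 1
    rw [← ENNReal.ofReal_coe_nnreal]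
    norm_num
  rw [hc2] at he hh
  rw [hc107] at h3
  have hA : ∑' v : Lattice d, ∑' v', p (cubeDist v) * q (supNorm (v - v')) ≤
      ENNReal.ofReal (2 ^ d * α⁻¹ ^ d) * E ^ 2 := by
    rw [tsum_mul_sub_left (fun v => p (cubeDist v)) (fun v => q (supNorm v)),
      ENNReal.ofReal_mul (by positivity)]
    exact (mul_le_mul' he hs).trans (le_of_eq (by ring))
  have hA' : ∑' v : Lattice d, ∑' v', p (cubeDist v') * q (supNorm (v - v')) ≤
      ENNReal.ofReal (2 ^ d * α⁻¹ ^ d) * E ^ 2 := by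
    rw [tsum_mul_sub_right (fun v => p (cubeDist v)) (fun v => q (supNorm v)),
      ENNReal.ofReal_mul (by positivity)]
    exact (mul_le_mul' he hs).trans (le_of_eq (by ring))
  have h22 : (2 : ℝ) ^ d * 2 ^ d = 4 ^ d := by
    rw [← mul_pow]
    norm_num
  have hB : ∑' v : Lattice d, ∑' v' : Lattice d, p (cubeDist v) * p (cubeDist v') ≤
      ENNReal.ofReal (4 ^ d) * E ^ 2 := by
    simp_rw [ENNReal.tsum_mul_left, ENNReal.tsum_mul_right]
    rw [← h22, ENNReal.ofReal_mul (by positivity)]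
    exact (mul_le_mul' he he).trans (le_of_eq (by ring))
  rcases Nat.lt_or_ge d 2 with hd1 | hd2
  · obtain rfl : d = 1 := by omega
    calc ∑' v : Lattice 1, ∑' v', pairBound p q v v'
        ≤ ∑' v : Lattice 1, ∑' v', (p (cubeDist v) * q (supNorm (v - v')) +
            p (cubeDist v') * q (supNorm (v - v')) + p (cubeDist v) * p (cubeDist v')) :=
          ENNReal.tsum_le_tsum fun v => ENNReal.tsum_le_tsum fun v' =>
            pairBound_le_of_dim_one p q v v'
      _ ≤ ENNReal.ofReal (2 ^ 1 * α⁻¹ ^ 1) * E ^ 2 + ENNReal.ofReal (2 ^ 1 * α⁻¹ ^ 1) * E ^ 2 +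
            ENNReal.ofReal (4 ^ 1) * E ^ 2 := by
          simp_rw [ENNReal.tsum_add]
          gcongr
      _ = ENNReal.ofReal (2 ^ 1 * α⁻¹ ^ 1 + 2 ^ 1 * α⁻¹ ^ 1 + 4 ^ 1) * E ^ 2 := by
          rw [ENNReal.ofReal_add (by positivity) (by positivity),
            ENNReal.ofReal_add (by positivity) (by positivity)]
          ring
      _ ≤ _ := by
          gcongr
          linarith
  have hC : ∑' v : Lattice d, ∑' v', (if 3 ≤ cubeDist v then p (cubeDist v) else 0) *
      p ((supNorm (v - v') + 1) / 2) ≤ ENNReal.ofReal ((20 / 7) ^ d) * E ^ 2 := by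
    rw [tsum_mul_sub_left (fun v => if 3 ≤ cubeDist v then p (cubeDist v) else 0)
      (fun v => p ((supNorm v + 1) / 2)), show (20 / 7 : ℝ) = 10 / 7 * 2 by norm_num, mul_pow,
      ENNReal.ofReal_mul (by positivity)]
    exact (mul_le_mul' h3 hh).trans (le_of_eq (by ring))
  have hC' : ∑' v : Lattice d, ∑' v', (if 3 ≤ cubeDist v' then p (cubeDist v') else 0) *
      p ((supNorm (v - v') + 1) / 2) ≤ ENNReal.ofReal ((20 / 7) ^ d) * E ^ 2 := by
    rw [tsum_mul_sub_right (fun v => if 3 ≤ cubeDist v then p (cubeDist v) else 0)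
      (fun v => p ((supNorm v + 1) / 2)), show (20 / 7 : ℝ) = 10 / 7 * 2 by norm_num, mul_pow,
      ENNReal.ofReal_mul (by positivity)]
    exact (mul_le_mul' h3 hh).trans (le_of_eq (by ring))
  have hF : ∑' v : Lattice d, ∑' v', (if cubeDist v < supNorm (v - v') then 1 else 0) *
      (p ((supNorm (v - v') + 1) / 2) * p ((supNorm (v - v') + 1) / 2)) ≤
      ENNReal.ofReal (4 ^ d) * E ^ 2 := by
    rw [ENNReal.ofReal_pow (by norm_num), ENNReal.ofReal_ofNat]
    exact tsum_far_le hN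
  calc ∑' v : Lattice d, ∑' v', pairBound p q v v' ≤ _ :=
        ENNReal.tsum_le_tsum fun v => ENNReal.tsum_le_tsum fun v' => pairBound_le p q v v'
    _ ≤ ENNReal.ofReal (2 ^ d * α⁻¹ ^ d) * E ^ 2 + ENNReal.ofReal (2 ^ d * α⁻¹ ^ d) * E ^ 2 +
          ENNReal.ofReal (4 ^ d) * E ^ 2 + (ENNReal.ofReal ((20 / 7) ^ d) * E ^ 2 +
          ENNReal.ofReal ((20 / 7) ^ d) * E ^ 2 + ENNReal.ofReal (4 ^ d) * E ^ 2) := by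
        simp_rw [ENNReal.tsum_add]
        gcongr
    _ = ENNReal.ofReal (2 ^ d * α⁻¹ ^ d + 2 ^ d * α⁻¹ ^ d + 4 ^ d +
          ((20 / 7) ^ d + (20 / 7) ^ d + 4 ^ d)) * E ^ 2 := by
        rw [ENNReal.ofReal_add (by positivity) (by positivity),
          ENNReal.ofReal_add (by positivity) (by positivity),
          ENNReal.ofReal_add (by positivity) (by positivity),
          ENNReal.ofReal_add (by positivity) (by positivity),
          ENNReal.ofReal_add (by positivity) (by positivity)]
        ring
    _ ≤ _ := by
        gcongr
        obtain ⟨k, rfl⟩ : ∃ k, d = k + 2 := ⟨d - 2, by omega⟩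
        have h4 : (2 : ℝ) ^ (k + 2) ≤ 1 / 4 * 4 ^ (k + 2) := by
          have : (2 : ℝ) ^ k ≤ 4 ^ k := by gcongr; norm_num
          rw [pow_add, pow_add]
          linarith
        -- `2 * (1 / 4) + 1 + 2 * (25 / 49) + 1 ≤ 15 / 4`
        have h5 : (20 / 7 : ℝ) ^ (k + 2) ≤ 25 / 49 * 4 ^ (k + 2) := by
          have : (20 / 7 : ℝ) ^ k ≤ 4 ^ k := by gcongr; norm_num
          rw [pow_add, pow_add]
          linarith
        have h6 : (0 : ℝ) < 4 ^ (k + 2) := by positivity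
        nlinarith [mul_le_mul_of_nonneg_right h4 (zero_le_one.trans hα),
          mul_le_mul_of_nonneg_left hα h6.le]

end Counting

/-! ### Joint tails of the coding radii -/

section Tails

variable {d : ℕ} {Ω A B : Type*} [MeasurableSpace Ω] [MeasurableSpace A]
  {P : Measure Ω} {ϱ : Measure A} {X : Ω → Lattice d → A}

theorem IsIIDField.measurable_field (hX : IsIIDField P ϱ X) : Measurable X :=
  measurable_pi_lambda _ hX.measurable

theorem IsIIDField.shift (hX : IsIIDField P ϱ X) (j : Lattice d) :
    IsIIDField P ϱ fun ω => shift j (X ω) where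
  measurable i := hX.measurable (i + j)
  indep := hX.indep.precomp (add_left_injective j)
  law i := hX.law (i + j)

variable [IsProbabilityMeasure P]

theorem IsIIDField.isProbabilityMeasure (hX : IsIIDField P ϱ X) : IsProbabilityMeasure ϱ := by
  rw [← hX.law 0]
  exact Measure.isProbabilityMeasure_map (hX.measurable 0).aemeasurable

theorem IsIIDField.map_eq (hX : IsIIDField P ϱ X) :
    haveI := hX.isProbabilityMeasure
    P.map X = Measure.infinitePi fun _ => ϱ := by
  have := hX.isProbabilityMeasure
  have h := (iIndepFun_iff_map_fun_eq_infinitePi_map hX.measurable).1 hX.indep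
  simp_rw [hX.law] at h
  exact h

theorem IsIIDField.map_shift (hX : IsIIDField P ϱ X) (j : Lattice d) :
    P.map (fun ω => FinitaryCoding.shift j (X ω)) = P.map X := by
  have := hX.isProbabilityMeasure
  rw [(hX.shift j).map_eq, hX.map_eq]

theorem IsIIDField.ae_shift (hX : IsIIDField P ϱ X) (j : Lattice d) {p : (Lattice d → A) → Prop}
    (hp : ∀ᵐ x ∂P.map X, p x) : ∀ᵐ ω ∂P, p (FinitaryCoding.shift j (X ω)) := by
  rw [← hX.map_shift j] at hp
  exact ae_of_ae_map (hX.shift j).measurable_field.aemeasurable hp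

theorem IsIIDField.measure_shift (hX : IsIIDField P ϱ X) (j : Lattice d) {S : Set (Lattice d → A)}
    (hS : MeasurableSet S) : P {ω | FinitaryCoding.shift j (X ω) ∈ S} = P {ω | X ω ∈ S} := by
  have h := congrArg (fun μ => μ S) (hX.map_shift j)
  rwa [Measure.map_apply (hX.shift j).measurable_field hS,
    Measure.map_apply hX.measurable_field hS] at h

variable {ρ : (Lattice d → A) → ℕ∞}

theorem measurableSet_natCast_le_radius (hρ : ∀ n : ℕ, MeasurableSet {x | ρ x ≤ n}) (a : ℕ) :
    MeasurableSet {x | (a : ℕ∞) ≤ ρ x} := by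
  rcases a with _ | a
  · simp
  · have : {x | ((a + 1 : ℕ) : ℕ∞) ≤ ρ x} = {x | ρ x ≤ a}ᶜ := by
      ext x
      simp only [Set.mem_ofPred_eq, Set.mem_compl_iff, not_le]
      push_cast
      exact ENat.add_one_le_iff (ENat.natCast_ne_top a)
    rw [this]
    exact (hρ a).compl

/-- The events that the radii at two sites are large are independent if they are decided in disjoint
balls. -/
theorem IsIIDField.measure_radius_inter_eq (hX : IsIIDField P ϱ X)
    (hρ : ∀ n : ℕ, MeasurableSet {x | ρ x ≤ n})
    (hloc : ∀ (x x' : Lattice d → A) (n : ℕ),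
      (∀ i ∈ Metric.closedBall (0 : Lattice d) (n : ℝ), x' i = x i) → ρ x ≤ n → ρ x' ≤ n)
    {j k : Lattice d} {a b : ℕ} (ha : 1 ≤ a) (hb : 1 ≤ b) (hab : a + b ≤ supNorm (j - k) + 1) :
    P {ω | (a : ℕ∞) ≤ ρ (FinitaryCoding.shift j (X ω)) ∧
        (b : ℕ∞) ≤ ρ (FinitaryCoding.shift k (X ω))} =
      P {ω | (a : ℕ∞) ≤ ρ (X ω)} * P {ω | (b : ℕ∞) ≤ ρ (X ω)} := by
  have hΩ : Nonempty Ω := nonempty_of_isProbabilityMeasure P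
  let a₀ : A := X hΩ.some 0
  let ball : Lattice d → ℕ → Finset (Lattice d) := fun j n =>
    Finset.Icc (fun m => j m - (n : ℤ)) (fun m => j m + (n : ℤ))
  -- the events are rewritten as functions of the restrictions of `X` to the two balls
  let ext : ∀ S : Finset (Lattice d), (S → A) → Lattice d → A := fun S w p =>
    if hp : p ∈ S then w ⟨p, hp⟩ else a₀
  have hext : ∀ S, Measurable (ext S) := fun S => measurable_pi_lambda _ fun p => by
    by_cases hp : p ∈ S
    · simp only [ext, dif_pos hp]
      fun_prop
    · simp only [ext, dif_neg hp]
      exact measurable_const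
  have hdec : ∀ (j : Lattice d) (n : ℕ) (x x' : Lattice d → A), (∀ p ∈ ball j n, x' p = x p) →
      (ρ (FinitaryCoding.shift j x) ≤ n ↔ ρ (FinitaryCoding.shift j x') ≤ n) := by
    intro j n x x' h
    have hmem : ∀ i ∈ Metric.closedBall (0 : Lattice d) (n : ℝ), i + j ∈ ball j n := by
      intro i hi
      rw [mem_closedBall_zero_iff, norm_eq_supNorm, Nat.cast_le, supNorm_le_iff] at hi
      refine Finset.mem_Icc.2 ⟨fun m => ?_, fun m => ?_⟩
      all_goals
        have := abs_le.1 (hi m)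
        simp only [Pi.add_apply]
        omega
    exact ⟨hloc _ _ n fun i hi => h _ (hmem i hi), hloc _ _ n fun i hi => (h _ (hmem i hi)).symm⟩
  have hev : ∀ (j : Lattice d) (a : ℕ), 1 ≤ a →
      {ω | (a : ℕ∞) ≤ ρ (FinitaryCoding.shift j (X ω))} =
        (fun ω (i : ball j (a - 1)) => X ω i) ⁻¹'
          (ext (ball j (a - 1)) ⁻¹' {x | (a : ℕ∞) ≤ ρ (FinitaryCoding.shift j x)}) := by
    intro j a ha
    obtain ⟨a, rfl⟩ : ∃ a', a = a' + 1 := ⟨a - 1, by omega⟩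
    ext ω
    have h := hdec j a (X ω) (ext (ball j a) fun i => X ω i) fun p hp => by simp [ext, hp]
    have hc : ∀ y : ℕ∞, ((a + 1 : ℕ) : ℕ∞) ≤ y ↔ ¬ y ≤ a := fun y => by
      rw [not_le]
      push_cast
      exact ENat.add_one_le_iff (ENat.natCast_ne_top a)
    simp only [Set.mem_ofPred_eq, Set.mem_preimage, hc]
    exact not_congr h
  have hdisj : Disjoint (ball j (a - 1)) (ball k (b - 1)) := by
    rw [Finset.disjoint_left]
    intro p hj hk
    have hj := Finset.mem_Icc.1 hj
    have hk := Finset.mem_Icc.1 hk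
    have : supNorm (j - k) ≤ a - 1 + (b - 1) := by
      rw [supNorm_le_iff]
      intro m
      have h1 := hj.1 m
      have h2 := hj.2 m
      have h3 := hk.1 m
      have h4 := hk.2 m
      simp only at h1 h2 h3 h4
      rw [abs_le, Pi.sub_apply]
      push_cast
      omega
    omega
  have hind := hX.indep.indepFun_finset _ _ hdisj hX.measurable
  have hSm : ∀ (j : Lattice d) (a : ℕ),
      MeasurableSet {x : Lattice d → A | (a : ℕ∞) ≤ ρ (FinitaryCoding.shift j x)} := fun j a =>
    (measurableSet_natCast_le_radius hρ a).preimage (measurable_shift j)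
  have h := hind.measure_inter_preimage_eq_mul _ _ ((hSm j a).preimage (hext _))
    ((hSm k b).preimage (hext _))
  rw [← hev j a ha, ← hev k b hb] at h
  have hsj := hX.measure_shift j (measurableSet_natCast_le_radius hρ a)
  have hsk := hX.measure_shift k (measurableSet_natCast_le_radius hρ b)
  simp only [Set.mem_ofPred_eq] at hsj hsk
  rw [hsj, hsk] at h
  exact h

theorem ofReal_le_toENNReal_iff (s : ℝ) (y : ℕ∞) :
    ENNReal.ofReal s ≤ (y : ℝ≥0∞) ↔ (⌈s⌉₊ : ℕ∞) ≤ y := by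
  induction y using ENat.recTopCoe with
  | top => simp
  | coe n =>
    rw [ENat.toENNReal_coe, ENNReal.ofReal_le_natCast, Nat.cast_le, Nat.ceil_le]

/-- Short-range factorization, applied at the two sites `j` and `k` and a third point at distance
`a` from `j` on the side opposite to `k`. -/
theorem measure_radius_inter_le_of_srf (hd : 1 ≤ d) (hX : IsIIDField P ϱ X)
    {φ : (Lattice d → A) → (Lattice d → B)} {α : ℝ} (hsrf : ShortRangeFactorization P X φ α)
    (hρ : ∀ n : ℕ, MeasurableSet {x | ρ x ≤ n}) (hρφ : ρ =ᵐ[P.map X] codingRadius φ)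
    (j k : Lattice d) (a : ℕ) :
    P {ω | (a : ℕ∞) ≤ ρ (shift j (X ω)) ∧
        ((supNorm (j - k) : ℕ) : ℕ∞) ≤ ρ (shift k (X ω))} ≤
      P {ω | (a : ℕ∞) ≤ ρ (X ω)} *
        P {ω | (⌈α * (supNorm (j - k) : ℕ)⌉₊ : ℕ∞) ≤ ρ (X ω)} := by
  let i : Lattice d := fun m => if j m ≤ k m then j m - a else j m + a
  have hji : ‖j - i‖ = a := by
    have hcoord : ∀ m, (j m - i m).natAbs = a := fun m => by
      simp only [i]
      split_ifs <;> omega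
    rw [norm_eq_supNorm]
    have : supNorm (j - i) = a := by
      have hne : (Finset.univ : Finset (Fin d)).Nonempty := ⟨⟨0, hd⟩, Finset.mem_univ _⟩
      simp only [supNorm, Pi.sub_apply, hcoord]
      exact Finset.sup_const hne a
    rw [this]
  have hkj : ‖k - j‖ = (supNorm (j - k) : ℕ) := by rw [norm_sub_rev, norm_eq_supNorm]
  have h1 : ‖j - i‖ ≤ ‖k - i‖ := by
    refine (pi_norm_le_iff_of_nonneg (norm_nonneg _)).2 fun m => ?_
    refine le_trans ?_ (norm_le_pi_norm (k - i) m)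
    simp only [Pi.sub_apply, Int.norm_eq_abs, i]
    have : |j m - (if j m ≤ k m then j m - a else j m + a)| ≤
        |k m - (if j m ≤ k m then j m - a else j m + a)| := by
      simp only [Int.abs_eq_natAbs]
      split_ifs <;> omega
    exact_mod_cast this
  have h2 : ‖k - j‖ ≤ ‖k - i‖ := by
    refine (pi_norm_le_iff_of_nonneg (norm_nonneg _)).2 fun m => ?_
    refine le_trans ?_ (norm_le_pi_norm (k - i) m)
    simp only [Pi.sub_apply, Int.norm_eq_abs, i]
    have : |k m - j m| ≤ |k m - (if j m ≤ k m then j m - a else j m + a)| := by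
      simp only [Int.abs_eq_natAbs]
      split_ifs <;> omega
    exact_mod_cast this
  have h := hsrf j k i (by rw [max_eq_left h1, max_eq_left h2])
  rw [hji, hkj] at h
  have hae : ∀ l, ∀ᵐ ω ∂P, ρ (shift l (X ω)) = codingRadiusAt φ l (X ω) := fun l =>
    hX.ae_shift l hρφ
  have e1 : P {ω | (a : ℕ∞) ≤ ρ (shift j (X ω)) ∧
      ((supNorm (j - k) : ℕ) : ℕ∞) ≤ ρ (shift k (X ω))} =
      P {ω | ENNReal.ofReal (a : ℝ) ≤ (codingRadiusAt φ j (X ω) : ℝ≥0∞) ∧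
        ENNReal.ofReal ((supNorm (j - k) : ℕ) : ℝ) ≤ (codingRadiusAt φ k (X ω) : ℝ≥0∞)} := by
    refine measure_congr ?_
    filter_upwards [hae j, hae k] with ω hj hk
    refine propext ?_
    change (_ ∧ _) ↔ (_ ∧ _)
    rw [ofReal_le_toENNReal_iff, ofReal_le_toENNReal_iff, hj, hk, Nat.ceil_natCast,
      Nat.ceil_natCast]
  have e2 : ∀ (s : ℝ) (l : Lattice d), P {ω | (⌈s⌉₊ : ℕ∞) ≤ ρ (X ω)} =
      P {ω | ENNReal.ofReal s ≤ (codingRadiusAt φ l (X ω) : ℝ≥0∞)} := by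
    intro s l
    have hs := hX.measure_shift l (measurableSet_natCast_le_radius hρ ⌈s⌉₊)
    rw [← show _ = P {ω | (⌈s⌉₊ : ℕ∞) ≤ ρ (X ω)} from hs]
    refine measure_congr ?_
    filter_upwards [hae l] with ω hl
    refine propext ?_
    change (⌈s⌉₊ : ℕ∞) ≤ ρ (shift l (X ω)) ↔
      ENNReal.ofReal s ≤ (codingRadiusAt φ l (X ω) : ℝ≥0∞)
    rw [ofReal_le_toENNReal_iff, hl]
  have e2a := e2 (a : ℝ) j
  rw [Nat.ceil_natCast] at e2a
  rw [e1, e2a, e2 _ k]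
  exact h

/-- The joint tails of the radii at two sites are bounded by `pairBound`. -/
theorem measure_radius_inter_le_pairBound (hd : 1 ≤ d) (hX : IsIIDField P ϱ X)
    {φ : (Lattice d → A) → (Lattice d → B)} {α : ℝ} (hsrf : ShortRangeFactorization P X φ α)
    (hρ : ∀ n : ℕ, MeasurableSet {x | ρ x ≤ n})
    (hloc : ∀ (x x' : Lattice d → A) (n : ℕ),
      (∀ i ∈ Metric.closedBall (0 : Lattice d) (n : ℝ), x' i = x i) → ρ x ≤ n → ρ x' ≤ n)
    (hρφ : ρ =ᵐ[P.map X] codingRadius φ) (j k u : Lattice d) :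
    P {ω | (cubeDist (j - u) : ℕ∞) ≤ ρ (shift j (X ω)) ∧
        (cubeDist (k - u) : ℕ∞) ≤ ρ (shift k (X ω))} ≤
      pairBound (fun a => P {ω | (a : ℕ∞) ≤ ρ (X ω)})
        (fun c => P {ω | (⌈α * (c : ℕ)⌉₊ : ℕ∞) ≤ ρ (X ω)}) (j - u) (k - u) := by
  unfold pairBound
  rw [sub_sub_sub_cancel_right]
  have ha := one_le_cubeDist (j - u)
  have hb := one_le_cubeDist (k - u)
  set a := cubeDist (j - u)
  set b := cubeDist (k - u)
  set c := supNorm (j - k) with hc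
  simp only
  have hmono : ∀ {a' b' : ℕ}, a' ≤ a → b' ≤ b →
      P {ω | (a : ℕ∞) ≤ ρ (shift j (X ω)) ∧ (b : ℕ∞) ≤ ρ (shift k (X ω))} ≤
        P {ω | (a' : ℕ∞) ≤ ρ (shift j (X ω)) ∧ (b' : ℕ∞) ≤ ρ (shift k (X ω))} :=
    fun h1 h2 => measure_mono fun ω hω =>
      ⟨(Nat.cast_le.2 h1).trans hω.1, (Nat.cast_le.2 h2).trans hω.2⟩
  have hind : ∀ {a' b' : ℕ}, 1 ≤ a' → 1 ≤ b' → a' ≤ a → b' ≤ b → a' + b' ≤ c + 1 →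
      P {ω | (a : ℕ∞) ≤ ρ (shift j (X ω)) ∧ (b : ℕ∞) ≤ ρ (shift k (X ω))} ≤
        P {ω | (a' : ℕ∞) ≤ ρ (X ω)} * P {ω | (b' : ℕ∞) ≤ ρ (X ω)} :=
    fun h1 h2 h3 h4 h5 => (hmono h3 h4).trans (hX.measure_radius_inter_eq hρ hloc h1 h2 h5).le
  -- the cases in the order of the definition of `pairBound`
  split_ifs
  · exact (hmono le_rfl (by assumption)).trans
      (measure_radius_inter_le_of_srf hd hX hsrf hρ hρφ j k a)
  · refine (hmono (a' := c) (b' := b) (by assumption) le_rfl).trans ?_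
    have h := measure_radius_inter_le_of_srf hd hX hsrf hρ hρφ k j b
    have hcomm : supNorm (k - j) = c := by
      simp only [hc, supNorm, Pi.sub_apply]
      congr 1
      funext m
      omega
    rw [hcomm] at h
    refine le_trans (measure_mono fun ω hω => ?_) h
    exact ⟨hω.2, hω.1⟩
  · exact hind ha hb le_rfl le_rfl (by assumption)
  · exact hind ha (by omega) le_rfl (by omega) (by omega)
  · rw [mul_comm]
    exact hind (by omega) hb (by omega) le_rfl (by omega)
  · exact hind (by omega) (by omega) (by omega) (by omega) (by omega)

end Tails

/-! ### Truncation and passage to the limit -/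

section Truncation

variable {d : ℕ} {A B : Type*}

/-- The radius `ρ` cut off at the level `r`. -/
noncomputable def truncRadius (ρ : (Lattice d → A) → ℕ∞) (r : ℕ) (x : Lattice d → A) : ℕ :=
  (min (ρ x) r).toNat

open Classical in
/-- The coded symbol at the origin, replaced by the constant `b₀` where the radius exceeds `r`. -/
noncomputable def truncCode (φ : (Lattice d → A) → (Lattice d → B)) (ρ : (Lattice d → A) → ℕ∞)
    (b₀ : B) (r : ℕ) (x : Lattice d → A) : B :=
  if ρ x ≤ r then φ x 0 else b₀

variable {φ : (Lattice d → A) → (Lattice d → B)} {ρ : (Lattice d → A) → ℕ∞} {b₀ : B} {r : ℕ}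

theorem truncRadius_le (x : Lattice d → A) : truncRadius ρ r x ≤ r :=
  ENat.toNat_le_of_le_natCast (min_le_right _ _)

theorem natCast_truncRadius (x : Lattice d → A) :
    ((truncRadius ρ r x : ℕ) : ℕ∞) = min (ρ x) r :=
  ENat.natCast_toNat (ne_top_of_le_ne_top (ENat.natCast_ne_top r) (min_le_right _ _))

theorem measurable_truncRadius [MeasurableSpace A] (hρ : ∀ n : ℕ, MeasurableSet {x | ρ x ≤ n}) :
    Measurable (truncRadius ρ r) := by
  refine measurable_of_Iic fun n => ?_
  have : truncRadius ρ r ⁻¹' Set.Iic n = {x | ρ x ≤ n} ∪ {_x | r ≤ n} := by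
    ext x
    simp only [Set.mem_preimage, Set.mem_Iic, Set.mem_union, Set.mem_ofPred_eq]
    rw [← Nat.cast_le (α := ℕ∞), natCast_truncRadius, min_le_iff, Nat.cast_le]
  rw [this]
  exact (hρ n).union (MeasurableSet.const _)

theorem measurable_truncCode [MeasurableSpace A] [MeasurableSpace B] (hφ : Measurable φ)
    (hρ : ∀ n : ℕ, MeasurableSet {x | ρ x ≤ n}) : Measurable (truncCode φ ρ b₀ r) :=
  Measurable.ite (hρ r) ((measurable_pi_apply 0).comp hφ) measurable_const

/-- The truncated radius and code are decided within the truncated radius. -/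
theorem truncCode_eq_of_eq_on_ball (hφρ : ∀ x, codingRadius φ x ≤ ρ x)
    (hloc : ∀ (x x' : Lattice d → A) (n : ℕ),
      (∀ i ∈ Metric.closedBall (0 : Lattice d) (n : ℝ), x' i = x i) → ρ x ≤ n → ρ x' ≤ n)
    {x x' : Lattice d → A}
    (h : ∀ i : Lattice d, (∀ m, |i m| ≤ (truncRadius ρ r x : ℤ)) → x' i = x i) :
    truncRadius ρ r x' = truncRadius ρ r x ∧ truncCode φ ρ b₀ r x' = truncCode φ ρ b₀ r x := by
  have hball : ∀ n : ℕ, n ≤ truncRadius ρ r x →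
      ∀ i ∈ Metric.closedBall (0 : Lattice d) (n : ℝ), x' i = x i := by
    intro n hn i hi
    rw [mem_closedBall_zero_iff, norm_eq_supNorm, Nat.cast_le] at hi
    exact h i (supNorm_le_iff.1 (hi.trans hn))
  have hiff : ∀ n : ℕ, n ≤ truncRadius ρ r x → (ρ x' ≤ n ↔ ρ x ≤ n) := fun n hn =>
    ⟨hloc x' x n fun i hi => (hball n hn i hi).symm, hloc x x' n (hball n hn)⟩
  by_cases hr : ρ x ≤ r
  · have hρx : ((truncRadius ρ r x : ℕ) : ℕ∞) = ρ x := by rw [natCast_truncRadius, min_eq_left hr]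
    set s := truncRadius ρ r x
    have hs : ρ x' = s := by
      refine le_antisymm ((hiff s le_rfl).2 hρx.ge) ?_
      by_contra! hlt
      obtain ⟨n, hn⟩ := ENat.ne_top_iff_exists.1 hlt.ne_top
      rw [← hn, Nat.cast_lt] at hlt
      have := (hiff n hlt.le).1 hn.ge
      rw [← hρx, Nat.cast_le] at this
      omega
    have hr' : ρ x' ≤ r := by rw [hs, hρx]; exact hr
    refine ⟨?_, ?_⟩
    · rw [← Nat.cast_inj (R := ℕ∞), natCast_truncRadius, min_eq_left hr', hs]
    · rw [truncCode, truncCode, if_pos hr, if_pos hr']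
      exact (codingRadius_le_iff φ x s).1 ((hφρ x).trans hρx.ge) x' (hball s le_rfl)
  · have hρx : truncRadius ρ r x = r := by
      rw [← Nat.cast_inj (R := ℕ∞), natCast_truncRadius, min_eq_right (not_le.1 hr).le]
    have hr' : ¬ ρ x' ≤ r := by rw [hiff r hρx.ge]; exact hr
    refine ⟨?_, ?_⟩
    · rw [hρx, ← Nat.cast_inj (R := ℕ∞), natCast_truncRadius, min_eq_right (not_le.1 hr').le]
    · rw [truncCode, truncCode, if_neg hr, if_neg hr']

end Truncation

section Limit

variable {d : ℕ} {Ω A B : Type*} [MeasurableSpace Ω] [MeasurableSpace A]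
  {P : Measure Ω} [IsProbabilityMeasure P] {ϱ : Measure A} {X : Ω → Lattice d → A}

theorem IsIIDField.ae_radius_lt_top (hX : IsIIDField P ϱ X) {ρ : (Lattice d → A) → ℕ∞}
    {φ : (Lattice d → A) → (Lattice d → B)} (hρ : ∀ n : ℕ, MeasurableSet {x | ρ x ≤ n})
    (hρφ : ρ =ᵐ[P.map X] codingRadius φ) (hφ : ∀ᵐ ω ∂P, codingRadius φ (X ω) < ⊤) :
    ∀ᵐ ω ∂P, ∀ j, ρ (FinitaryCoding.shift j (X ω)) < ⊤ := by
  rw [ae_all_iff]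
  intro j
  refine hX.ae_shift j (p := fun x => ρ x < ⊤) ?_
  have hset : {x | ρ x < ⊤} = ⋃ n : ℕ, {x | ρ x ≤ n} := by
    ext x
    simp only [Set.mem_ofPred_eq, Set.mem_iUnion]
    constructor
    · intro h
      obtain ⟨n, hn⟩ := ENat.ne_top_iff_exists.1 h.ne
      exact ⟨n, hn.ge⟩
    · rintro ⟨n, hn⟩
      exact hn.trans_lt (ENat.natCast_lt_top n)
  have hm : MeasurableSet {x | ρ x < ⊤} := by
    rw [hset]
    exact MeasurableSet.iUnion hρ
  rw [ae_map_iff hX.measurable_field.aemeasurable hm]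
  filter_upwards [hφ, ae_of_ae_map hX.measurable_field.aemeasurable hρφ] with ω h1 h2
  rw [h2]
  exact h1

open Classical in
/-- The Gaussian bound for a coding with finite mean volume `E`, as an inequality between real
numbers. -/
theorem integral_exp_le_of_coding [StandardBorelSpace A] [MeasurableSpace B]
    [StandardBorelSpace B] (hd : 1 ≤ d) (hX : IsIIDField P ϱ X)
    {φ : (Lattice d → A) → (Lattice d → B)}
    (hφ : IsFinitaryCoding P X φ) {α : ℝ} (hα0 : 0 < α) (hα1 : α ≤ 1)
    (hsrf : ShortRangeFactorization P X φ α) {Λ : Finset (Lattice d)} {f : (Lattice d → B) → ℝ}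
    (hfm : Measurable f) (hfC : ∃ C, ∀ y, |f y| ≤ C) (hfΛ : DependsOn f (Λ : Set (Lattice d)))
    {δ : Lattice d → ℝ} (hδ0 : ∀ j, 0 ≤ δ j) (hδΛ : ∀ j ∉ Λ, δ j = 0)
    (hf : ∀ y y', f y' ≤ f y + ∑ j ∈ Λ, if y j ≠ y' j then δ j else 0) {E : ℝ} (hE0 : 0 ≤ E)
    (hE : ∫⁻ ω, codingVolume φ (X ω) ∂P = ENNReal.ofReal E) {t : ℝ} (ht : 0 < t) :
    ∫ ω, Real.exp (t * f (φ (X ω))) ∂P ≤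
      Real.exp (t * ∫ ω, f (φ (X ω)) ∂P + 3 * α⁻¹ ^ d * t ^ 2 * E ^ 2 * ∑ j ∈ Λ, δ j ^ 2) := by
  have hϱ := hX.isProbabilityMeasure
  have hXm := hX.measurable_field
  obtain ⟨hφm, hφs⟩ := hφ.isCodingMap
  have hμ : IsProbabilityMeasure (P.map X) := Measure.isProbabilityMeasure_map hXm.aemeasurable
  obtain ⟨ρ, hρ, hφρ, hloc, hρφ⟩ := exists_measurable_radius (P.map X) hφm
  have hΩ : Nonempty Ω := nonempty_of_isProbabilityMeasure P
  let b₀ : B := φ (X hΩ.some) 0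
  have hfin := hX.ae_radius_lt_top hρ hρφ hφ.radius_lt_top
  have hfin0 : ∀ᵐ ω ∂P, ρ (X ω) < ⊤ := by
    filter_upwards [hfin] with ω hω
    have := hω 0
    rwa [show shift 0 (X ω) = X ω from funext fun i => by simp [shift]] at this
  -- the radius at the origin as a natural number
  let N : Ω → ℕ := fun ω => (ρ (X ω)).toNat
  have hNρ : ∀ᵐ ω ∂P, ((N ω : ℕ) : ℕ∞) = ρ (X ω) := by
    filter_upwards [hfin0] with ω hω
    exact ENat.natCast_toNat hω.ne
  have hN : Measurable N := by
    refine measurable_of_Iic fun n => ?_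
    have : N ⁻¹' Set.Iic n = X ⁻¹' ({x | ρ x ≤ n} ∪ (⋃ k : ℕ, {x | ρ x ≤ k})ᶜ) := by
      ext ω
      simp only [N, Set.mem_preimage, Set.mem_Iic, Set.mem_union, Set.mem_ofPred_eq,
        Set.mem_compl_iff, Set.mem_iUnion, not_exists, not_le]
      induction h : ρ (X ω) using ENat.recTopCoe with
      | top => simp
      | coe k =>
        simp only [ENat.toNat_natCast, Nat.cast_le, Nat.cast_lt]
        exact ⟨Or.inl, fun h => h.elim id fun h => absurd (h k) (lt_irrefl _)⟩
    rw [this]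
    exact ((hρ n).union (MeasurableSet.iUnion hρ).compl).preimage hXm
  have hEN : ∫⁻ ω, (2 * (N ω : ℝ≥0∞) + 1) ^ d ∂P = ENNReal.ofReal E := by
    rw [← hE]
    refine lintegral_congr_ae ?_
    filter_upwards [hNρ, ae_of_ae_map hXm.aemeasurable hρφ] with ω h1 h2
    rw [codingVolume, ← h2, ← h1, ENat.toENNReal_coe]
  have hE1 : 1 ≤ E := by
    have h1 : (1 : ℝ≥0∞) ≤ ENNReal.ofReal E := by
      rw [← hEN]
      calc (1 : ℝ≥0∞) = ∫⁻ _, 1 ∂P := by simp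
        _ ≤ _ := lintegral_mono fun ω => one_le_pow₀ le_add_self
    exact ENNReal.one_le_ofReal.1 h1
  have hp : ∀ a : ℕ, P {ω | (a : ℕ∞) ≤ ρ (X ω)} = P {ω | a ≤ N ω} := fun a => by
    refine measure_congr ?_
    filter_upwards [hNρ] with ω hω
    refine propext ?_
    change (a : ℕ∞) ≤ ρ (X ω) ↔ a ≤ N ω
    rw [← hω, Nat.cast_le]
  have hq : ∀ c : ℕ, P {ω | (⌈α * (c : ℕ)⌉₊ : ℕ∞) ≤ ρ (X ω)} = P {ω | α * c ≤ N ω} := fun c => by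
    rw [hp]
    simp_rw [Nat.ceil_le]
  set D := ∑ j ∈ Λ, δ j ^ 2 with hD
  have hD0 : 0 ≤ D := Finset.sum_nonneg fun j _ => sq_nonneg _
  have hα : (1 : ℝ) ≤ α⁻¹ ^ d := one_le_pow₀ ((one_le_inv₀ hα0).2 hα1)
  have hαp : (0 : ℝ) ≤ α⁻¹ ^ d := zero_le_one.trans hα
  -- the bound for the truncated code, uniformly in the truncation level
  have htrunc : ∀ r : ℕ,
      ∫ ω, Real.exp (t * f (fun j => truncCode φ ρ b₀ r (shift j (X ω)))) ∂P ≤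
        Real.exp (t * ∫ ω, f (fun j => truncCode φ ρ b₀ r (shift j (X ω))) ∂P +
          3 * α⁻¹ ^ d * t ^ 2 * E ^ 2 * D) := by
    intro r
    have hRm : Measurable (truncRadius ρ r) := measurable_truncRadius hρ
    have hsum : ∑' u, ENNReal.ofReal (∫ ω, reach Λ δ (truncRadius ρ r) u (X ω) ^ 2 ∂P) ≤
        ENNReal.ofReal (D * (15 / 4 * 4 ^ d * α⁻¹ ^ d * E ^ 2)) := by
      refine (tsum_reach_sq_le hXm hRm hδ0 hδΛ
        (W := pairBound (fun a => P {ω | a ≤ N ω}) fun c => P {ω | α * c ≤ N ω})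
        fun j k u => ?_).trans ?_
      · have h := measure_radius_inter_le_pairBound hd hX hsrf hρ hloc hρφ j k u
        rw [funext hq, funext hp] at h
        refine le_trans (measure_mono fun ω hω => ?_) h
        have hle : ∀ (l : Lattice d) (a : ℕ), a ≤ truncRadius ρ r (shift l (X ω)) →
            (a : ℕ∞) ≤ ρ (shift l (X ω)) := fun l a ha =>
          (Nat.cast_le.2 ha).trans (by rw [natCast_truncRadius]; exact min_le_left _ _)
        exact ⟨hle _ _ hω.1, hle _ _ hω.2⟩
      · rw [ENNReal.ofReal_mul hD0]
        gcongr
        refine (tsum_pairBound_le hd hN hα0 hα1).trans (le_of_eq ?_)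
        rw [hEN, ← ENNReal.ofReal_pow hE0, ← ENNReal.ofReal_mul (by positivity)]
    refine (integral_exp_le_of_tsum_le hX hRm (measurable_truncCode hφm hρ) truncRadius_le
      (fun x x' h => truncCode_eq_of_eq_on_ball hφρ hloc h) hfm hfC hδ0 hδΛ hf (by positivity)
      hsum ht).trans (Real.exp_le_exp.2 ?_)
    refine add_le_add le_rfl ?_
    have h4 : D * (15 / 4 * 4 ^ d * α⁻¹ ^ d * E ^ 2) / 4 ^ d = D * (15 / 4 * α⁻¹ ^ d * E ^ 2) := by
      have : (4 : ℝ) ^ d ≠ 0 := by positivity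
      field_simp
    rw [h4]
    have hE2 : 1 ≤ α⁻¹ ^ d * E ^ 2 := one_le_mul_of_one_le_of_one_le hα (one_le_pow₀ hE1)
    have h5 : t ^ 2 * (D / 2 + 2 / 3 * (D * (15 / 4 * α⁻¹ ^ d * E ^ 2))) =
        t ^ 2 * D * (1 / 2 + 5 / 2 * (α⁻¹ ^ d * E ^ 2)) := by ring
    have h6 : 3 * α⁻¹ ^ d * t ^ 2 * E ^ 2 * D = t ^ 2 * D * (3 * (α⁻¹ ^ d * E ^ 2)) := by ring
    rw [h5, h6]
    gcongr
    linarith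
  obtain ⟨C, hfC⟩ := hfC
  have hev : ∀ᵐ ω ∂P, ∀ᶠ r : ℕ in Filter.atTop,
      f (fun j => truncCode φ ρ b₀ r (shift j (X ω))) = f (φ (X ω)) := by
    filter_upwards [hfin] with ω hω
    have h1 : ∀ᶠ r : ℕ in Filter.atTop, ∀ j ∈ Λ, ρ (shift j (X ω)) ≤ r := by
      rw [Filter.eventually_all_finset]
      intro j _
      obtain ⟨n, hn⟩ := ENat.ne_top_iff_exists.1 (hω j).ne
      filter_upwards [Filter.eventually_ge_atTop n] with r hr
      rw [← hn]
      exact_mod_cast hr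
    filter_upwards [h1] with r hr
    refine hfΛ fun j hj => ?_
    rw [truncCode, if_pos (hr j hj), hφs]
    simp [shift]
  have hFm : ∀ r : ℕ, Measurable fun ω => f (fun j => truncCode φ ρ b₀ r (shift j (X ω))) :=
    fun r => hfm.comp (measurable_pi_lambda _ fun j =>
      (measurable_truncCode hφm hρ).comp ((measurable_shift j).comp hXm))
  have hlim1 : Filter.Tendsto (fun r : ℕ => ∫ ω, f (fun j => truncCode φ ρ b₀ r (shift j (X ω))) ∂P)
      Filter.atTop (nhds (∫ ω, f (φ (X ω)) ∂P)) := by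
    refine tendsto_integral_of_dominated_convergence (fun _ => C)
      (fun r => (hFm r).aestronglyMeasurable) (integrable_const _)
      (fun r => Filter.Eventually.of_forall fun ω => hfC _) ?_
    filter_upwards [hev] with ω hω
    exact tendsto_const_nhds.congr' (hω.mono fun r hr => hr.symm)
  have hlim2 : Filter.Tendsto
      (fun r : ℕ => ∫ ω, Real.exp (t * f (fun j => truncCode φ ρ b₀ r (shift j (X ω)))) ∂P)
      Filter.atTop (nhds (∫ ω, Real.exp (t * f (φ (X ω))) ∂P)) := by
    refine tendsto_integral_of_dominated_convergence (fun _ => Real.exp (t * C))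
      (fun r => ((hFm r).const_mul t).exp.aestronglyMeasurable) (integrable_const _)
      (fun r => Filter.Eventually.of_forall fun ω => ?_) ?_
    · rw [Real.norm_eq_abs, Real.abs_exp, Real.exp_le_exp]
      gcongr
      exact (abs_le.1 (hfC _)).2
    · filter_upwards [hev] with ω hω
      exact tendsto_const_nhds.congr' (hω.mono fun r hr => by simp only [hr])
  exact le_of_tendsto_of_tendsto' hlim2
    ((Real.continuous_exp.tendsto _).comp ((hlim1.const_mul t).add_const _)) htrunc

end Limit

section Oscillation

variable {d : ℕ} {B : Type*} {f : (Lattice d → B) → ℝ}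

theorem ofReal_abs_sub_le_oscillation (j : Lattice d) {y y' : Lattice d → B}
    (h : ∀ l, l ≠ j → y l = y' l) : ENNReal.ofReal |f y - f y'| ≤ oscillation f j :=
  le_iSup_of_le y (le_iSup_of_le y' (le_iSup_of_le h le_rfl))

theorem oscillation_eq_zero {Λ : Finset (Lattice d)} (hf : DependsOn f (Λ : Set (Lattice d)))
    {j : Lattice d} (hj : j ∉ Λ) : oscillation f j = 0 := by
  refine le_antisymm (iSup_le fun y => iSup_le fun y' => iSup_le fun h => ?_) zero_le
  have : f y = f y' := hf fun l hl => h l fun hlj => hj (hlj ▸ hl)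
  simp [this]

end Oscillation

end FinitaryCoding

theorem mainTheorem2 {d : ℕ} (hd : 1 ≤ d)
    {Ω A B : Type*} [MeasurableSpace Ω]
    [MeasurableSpace A] [StandardBorelSpace A] [MeasurableSpace B] [StandardBorelSpace B]
    (P : Measure Ω) [IsProbabilityMeasure P] (ϱ : Measure A)
    (X : Ω → FinitaryCoding.Lattice d → A) (hX : FinitaryCoding.IsIIDField P ϱ X)
    (φ : (FinitaryCoding.Lattice d → A) → (FinitaryCoding.Lattice d → B))
    (hφ : FinitaryCoding.IsFinitaryCoding P X φ)
    (α : ℝ) (hα0 : 0 < α) (hα1 : α ≤ 1)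
    (hsrf : FinitaryCoding.ShortRangeFactorization P X φ α)
    (f : (FinitaryCoding.Lattice d → B) → ℝ) (hf : Measurable f)
    (hloc : FinitaryCoding.IsLocal f) (hbd : FinitaryCoding.HasBoundedDifferences f) :
    Integrable (fun ω => f (φ (X ω))) P ∧
    ∀ t : ℝ, 0 < t →
      Integrable (fun ω => Real.exp (t * (f (φ (X ω)) - ∫ ω', f (φ (X ω')) ∂P))) P ∧
      ((Real.log (∫ ω, Real.exp (t * (f (φ (X ω)) - ∫ ω', f (φ (X ω')) ∂P)) ∂P) : ℝ) : EReal) ≤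
        ((ENNReal.ofReal (3 * α⁻¹ ^ d * t ^ 2) *
          (∫⁻ ω, FinitaryCoding.codingVolume φ (X ω) ∂P) ^ 2 *
          FinitaryCoding.oscillationNormSq f : ℝ≥0∞) : EReal) := by
  classical
  obtain ⟨Λ, hΛ⟩ := hloc
  have hΩ : Nonempty Ω := nonempty_of_isProbabilityMeasure P
  let δ : FinitaryCoding.Lattice d → ℝ := fun j => (FinitaryCoding.oscillation f j).toReal
  have hδ0 : ∀ j, 0 ≤ δ j := fun j => ENNReal.toReal_nonneg
  have hδΛ : ∀ j ∉ Λ, δ j = 0 := fun j hj => by simp [δ, FinitaryCoding.oscillation_eq_zero hΛ hj]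
  have hinc : ∀ y y', f y' ≤ f y + ∑ j ∈ Λ, if y j ≠ y' j then δ j else 0 := fun y y' =>
    FinitaryCoding.le_add_sum_of_dependsOn hΛ (fun j y b => by
      have h := FinitaryCoding.ofReal_abs_sub_le_oscillation (f := f) j
        (y := Function.update y j b) (y' := y)
        fun l hl => Function.update_of_ne hl _ _
      rw [ENNReal.ofReal_le_iff_le_toReal (hbd j).ne] at h
      have := (abs_le.1 h).2
      simp only [δ]
      linarith) y y'
  have hsum_le : ∀ y y' : FinitaryCoding.Lattice d → B,
      (∑ j ∈ Λ, if y j ≠ y' j then δ j else 0) ≤ ∑ j ∈ Λ, δ j :=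
    fun y y' => Finset.sum_le_sum fun j _ => by split_ifs <;> simp [hδ0 j]
  have hfC : ∃ C, ∀ y, |f y| ≤ C := by
    let y₀ := φ (X hΩ.some)
    refine ⟨|f y₀| + ∑ j ∈ Λ, δ j, fun y => abs_le.2 ⟨?_, ?_⟩⟩
    · have h1 := hinc y y₀
      have h2 := hsum_le y y₀
      have h3 := neg_abs_le (f y₀)
      linarith
    · have h1 := hinc y₀ y
      have h2 := hsum_le y₀ y
      have h3 := le_abs_self (f y₀)
      linarith
  obtain ⟨C, hC⟩ := hfC
  have hYm : Measurable fun ω => φ (X ω) := hφ.isCodingMap.measurable.comp hX.measurable_field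
  have hFm : Measurable fun ω => f (φ (X ω)) := hf.comp hYm
  refine ⟨FinitaryCoding.integrable_of_abs_le hFm fun ω => hC _, fun t ht => ?_⟩
  set m := ∫ ω', f (φ (X ω')) ∂P with hm
  have hcentred : ∀ ω, |f (φ (X ω)) - m| ≤ C + C := fun ω =>
    (abs_sub _ _).trans (add_le_add (hC _) (FinitaryCoding.abs_integral_le_of_abs_le fun ω => hC _))
  have hint : Integrable (fun ω => Real.exp (t * (f (φ (X ω)) - m))) P :=
    FinitaryCoding.integrable_exp_of_abs_le (hFm.sub_const m) hcentred t
  refine ⟨hint, ?_⟩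
  set D := ∑ j ∈ Λ, δ j ^ 2 with hD
  have hnorm : FinitaryCoding.oscillationNormSq f = ENNReal.ofReal D := by
    rw [FinitaryCoding.oscillationNormSq, tsum_eq_sum (s := Λ) fun j hj => by
      simp [FinitaryCoding.oscillation_eq_zero hΛ hj], hD,
      ENNReal.ofReal_sum_of_nonneg fun j _ => sq_nonneg _]
    refine Finset.sum_congr rfl fun j _ => ?_
    rw [ENNReal.ofReal_pow (hδ0 j), ENNReal.ofReal_toReal (hbd j).ne]
  have hD0 : 0 ≤ D := Finset.sum_nonneg fun j _ => sq_nonneg _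
  have hαp : 0 < 3 * α⁻¹ ^ d * t ^ 2 := by positivity
  rw [hnorm]
  rcases hD0.eq_or_lt with hD00 | hDpos
  · -- a function without oscillation is constant, whatever the mean volume is
    have hδz : ∀ j ∈ Λ, δ j = 0 := fun j hj => by
      have := (Finset.sum_eq_zero_iff_of_nonneg fun j _ => sq_nonneg (δ j)).1 hD00.symm j hj
      exact pow_eq_zero_iff two_ne_zero |>.1 this
    have hconst : ∀ y y', f y' ≤ f y := fun y y' => by
      have := (hinc y y').trans (add_le_add le_rfl (hsum_le y y'))
      rwa [Finset.sum_eq_zero hδz, add_zero] at this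
    have hzero : ∀ ω, f (φ (X ω)) - m = 0 := fun ω => by
      have : ∀ ω', f (φ (X ω')) = f (φ (X ω)) := fun ω' => le_antisymm (hconst _ _) (hconst _ _)
      rw [hm, integral_congr_ae (Filter.Eventually.of_forall this)]
      simp
    simp [hzero, ← hD00]
  rcases eq_or_ne (∫⁻ ω, FinitaryCoding.codingVolume φ (X ω) ∂P) ⊤ with htop | hfin
  · rw [htop, ENNReal.top_pow two_ne_zero, ENNReal.mul_top (by simpa using hαp),
      ENNReal.top_mul (by simpa using hDpos)]
    simp
  set E := (∫⁻ ω, FinitaryCoding.codingVolume φ (X ω) ∂P).toReal with hE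
  have hE0 : 0 ≤ E := ENNReal.toReal_nonneg
  have hEV : ∫⁻ ω, FinitaryCoding.codingVolume φ (X ω) ∂P = ENNReal.ofReal E :=
    (ENNReal.ofReal_toReal hfin).symm
  have key := FinitaryCoding.integral_exp_le_of_coding
    hd hX hφ hα0 hα1 hsrf hf ⟨C, hC⟩ hΛ hδ0 hδΛ hinc hE0 hEV ht
  rw [← hm, ← hD] at key
  rw [hEV, ← ENNReal.ofReal_pow hE0, ← ENNReal.ofReal_mul hαp.le,
    ← ENNReal.ofReal_mul (by positivity), EReal.coe_ennreal_ofReal,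
    max_eq_left (by positivity), EReal.coe_le_coe_iff]
  rw [Real.log_le_iff_le_exp (integral_exp_pos hint)]
  have hsplit : ∀ ω, Real.exp (t * (f (φ (X ω)) - m)) =
      Real.exp (-(t * m)) * Real.exp (t * f (φ (X ω))) := fun ω => by
    rw [← Real.exp_add]
    ring_nf
  simp_rw [hsplit]
  rw [integral_const_mul]
  calc Real.exp (-(t * m)) * ∫ ω, Real.exp (t * f (φ (X ω))) ∂P
      ≤ Real.exp (-(t * m)) * Real.exp (t * m + 3 * α⁻¹ ^ d * t ^ 2 * E ^ 2 * D) := by gcongr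
    _ = _ := by
        rw [← Real.exp_add]
        ring_nf
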